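/- **Proposition (Holonomy of $\Sigma$).** Let $\Sigma=\left\{\begin{pmatrix}x&y\\y&-x\end{pmatrix}:x,y\in\mathbb R\right\}\cong\mathbb R^2$, with polar coordinates $(x,y)=(r\cos\phi,r\sin\phi)$, and let $g$ be the cone metric on $\Sigma\setminus\{0\}$, i.e. the pullback of the Euclidean metric of $\mathbb R^3$ under $(x,y)\mapsto(x,y,\sqrt3\,r)$. Let $\nabla$ be its Levi-Civita connection, and consider the $g$-orthonormal frame $$e_1=\cos\phi\,\tfrac{\partial_r}{2}-\sin\phi\,\tfrac{\partial_\phi}{r},\qquad e_2=\sin\phi\,\tfrac{\partial_r}{2}+\cos\phi\,\tfrac{\partial_\phi}{r},$$ with connection form $\omega(X)=g(e_1,\nabla_Xe_2)$. For a curve $\gamma:[0,1]\to\Sigma$ put $$\theta(\gamma)=\int_0^1\omega(\gamma'(t))\,dt\ \text{ (geometric phase)},\qquad W(\gamma;0)=\frac1{2\pi}\int_\gamma d\phi\ \text{ (winding number, possibly non-integer)}.$$ A *loop* at $p\neq0$ is a piecewise smooth curve $\gamma:[0,1]\to\Sigma$ with $\gamma(0)=\gamma(1)=p$ which, whenever it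 passes through the origin, is smooth there with nonzero velocity (this condition is void for loops in $\Sigma\setminus\{0\}$). A vector field along $\gamma$ is *parallel* if it is continuous on $[0,1]$ and satisfies $\nabla_{\gamma'}V=0$ at the times at which $\gamma\neq0$ and $\gamma$ is differentiable. For $U=\Sigma\setminus\{0\}$ or $U=\Sigma$, let $\mathrm{Hol}_p(U)$ be the set of all parallel transports $V(0)\mapsto V(1)$ around loops in $U$ at $p$. A *smooth simple closed curve* is a smooth $1$-periodic map $\gamma:\mathbb R\to\Sigma$ with nowhere vanishing velocity which is injective on $[0,1)$. Let $p\in\Sigma\setminus\{0\}$. For every loop $\gamma$ in $\Sigma$ at $p$ the integrals above exist, $\theta(\gamma)=\pi\,W(\gamma;0)$, and parallel transport around $\gamma$ is a well-defined linear automorphism of $T_p\Sigma$, namely the rotation by the angle $\theta(\gamma)$ in the oriented frame $(e_1(p),e_2(p))$. Moreover: 1. $\mathrm{Hol}_p(\Sigma\setminus\{0\})$ is a group isomorphic to $\mathbb Z_2$. The phases modulo $2\pi$ of the loops in $\Sigma\setminus\{0\}$ at $p$ are exactly the multiples $k\pi$, $k\in\mathbb Z$. There is a smooth simple closed curve in $\Sigma\setminus\{0\}$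 based at $p$ with winding number $1$, and every loop in $\Sigma\setminus\{0\}$ at $p$ with winding number $1$ has phase $\pi$ and its holonomy generates the group. 2. $\mathrm{Hol}_p(\Sigma)$ is a group isomorphic to $\mathbb Z_4$. The phases modulo $2\pi$ of the loops in $\Sigma$ at $p$ are exactly the multiples $k\pi/2$, $k\in\mathbb Z$. Every smooth simple closed curve through the origin has winding number $\tfrac12$ and phase $\tfrac\pi2$, or (with the opposite orientation) winding number $-\tfrac12$ and phase $-\tfrac\pi2$; if it is based at $p$, its holonomy generates the group. There is such a curve based at $p$ with winding number $\tfrac12$. -/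

import Mathlib

open scoped ContDiff

noncomputable section

namespace ConeHolonomy

/-- The coordinate plane `ℝ²`; it also serves as the tangent space of `Σ` at each point, with
respect to the coordinate basis `∂_x, ∂_y`. -/
abbrev Plane : Type := Fin 2 → ℝ

/-- `Σ`, the vector space of real symmetric `2 × 2` matrices of trace zero. -/
def SymTraceless : Submodule ℝ (Matrix (Fin 2) (Fin 2) ℝ) where
  carrier := {A | A.IsSymm ∧ A.trace = 0}
  add_mem' := by
    rintro A B ⟨hA, hA'⟩ ⟨hB, hB'⟩
    exact ⟨hA.add hB, by rw [Matrix.trace_add, hA', hB', add_zero]⟩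
  zero_mem' := ⟨Matrix.isSymm_zero, Matrix.trace_zero _ _⟩
  smul_mem' := by
    rintro a A ⟨hA, hA'⟩
    exact ⟨hA.smul a, by rw [Matrix.trace_smul, hA', smul_zero]⟩

/-- The matrix with rows `(x, y)` and `(y, -x)`. -/
def toMat (q : Plane) : Matrix (Fin 2) (Fin 2) ℝ := !![q 0, q 1; q 1, -q 0]

theorem toMat_mem (q : Plane) : toMat q ∈ SymTraceless := by
  refine ⟨?_, ?_⟩
  · ext i j
    fin_cases i <;> fin_cases j <;> simp [toMat]
  · simp [toMat, Matrix.trace_fin_two]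

/-- The global cartesian chart `Φ` of `Σ`, sending the matrix with rows `(x, y)`, `(y, -x)` to
`(x, y)`. -/
def chart : SymTraceless ≃ₗ[ℝ] Plane where
  toFun A := ![A.1 0 0, A.1 0 1]
  invFun q := ⟨toMat q, toMat_mem q⟩
  map_add' A B := by
    ext i
    fin_cases i <;> simp
  map_smul' a A := by
    ext i
    fin_cases i <;> simp
  left_inv := by
    rintro ⟨A, hA, hA'⟩
    have h1 : A 1 0 = A 0 1 := hA.apply 0 1
    have h2 : A 0 0 + A 1 1 = 0 := by rw [← Matrix.trace_fin_two]; exact hA'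
    apply Subtype.ext
    ext i j
    fin_cases i <;> fin_cases j <;> simp [toMat, h1] <;> linarith
  right_inv q := by
    ext i
    fin_cases i <;> simp [toMat]

/-! ### The cone metric and its Levi-Civita connection

All tensors below are meant on `ℝ² ∖ {0}`; their (junk) values at the origin are never used. -/

/-- The coordinate vector `∂_i`. -/
def coordVec (i : Fin 2) : Plane := Pi.single i 1

/-- The radius `r`. -/
def radius (q : Plane) : ℝ := √(q 0 ^ 2 + q 1 ^ 2)

/-- The parametrization `(x, y) ↦ (x, y, √3 r)` of a cone in `ℝ³`. -/
def coneMap (q : Plane) : Fin 3 → ℝ := ![q 0, q 1, √3 * radius q]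

/-- The Jacobian matrix of the cone parametrization. -/
def coneJacobian (q : Plane) : Matrix (Fin 3) (Fin 2) ℝ :=
  Matrix.of fun k i => fderiv ℝ coneMap q (coordVec i) k

/-- The cone metric `g = Dfᵀ Df`, as the matrix `(g_{ij})`. -/
def metric (q : Plane) : Matrix (Fin 2) (Fin 2) ℝ := (coneJacobian q).transpose * coneJacobian q

/-- `g(X, Y)` at the point `q`. -/
def metricForm (q X Y : Plane) : ℝ := ∑ i, ∑ j, metric q i j * X i * Y j

/-- The partial derivative `∂_i h` at `q`. -/
def partialDeriv (i : Fin 2) (h : Plane → ℝ) (q : Plane) : ℝ := fderiv ℝ h q (coordVec i)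

/-- The Christoffel symbols `Γ^k_{ij}` of the Levi-Civita connection of `g`. -/
def christoffel (q : Plane) (k i j : Fin 2) : ℝ :=
  (1 / 2) * ∑ l, (metric q)⁻¹ k l *
    (partialDeriv i (fun z => metric z j l) q + partialDeriv j (fun z => metric z i l) q
      - partialDeriv l (fun z => metric z i j) q)

/-- The vector with components `Γ^k_{ij} X^i Y^j`. -/
def christoffelForm (q X Y : Plane) : Plane :=
  fun k => ∑ i, ∑ j, christoffel q k i j * X i * Y j

/-- The Levi-Civita covariant derivative `∇_X Y` at `q` of a vector field `Y`. -/
def covDeriv (q X : Plane) (Y : Plane → Plane) : Plane :=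
  fderiv ℝ Y q X + christoffelForm q X (Y q)

/-! ### The reference frame and the connection form -/

/-- `∂_r = cos φ ∂_x + sin φ ∂_y`. -/
def polarR (q : Plane) : Plane := ![q 0 / radius q, q 1 / radius q]

/-- `∂_φ = - r sin φ ∂_x + r cos φ ∂_y`. -/
def polarPhi (q : Plane) : Plane := ![-q 1, q 0]

/-- `e₁ = cos φ ∂_r / 2 - sin φ ∂_φ / r`. -/
def frameOne (q : Plane) : Plane :=
  (q 0 / radius q) • ((1 / 2 : ℝ) • polarR q) - (q 1 / radius q) • ((1 / radius q) • polarPhi q)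

/-- `e₂ = sin φ ∂_r / 2 + cos φ ∂_φ / r`. -/
def frameTwo (q : Plane) : Plane :=
  (q 1 / radius q) • ((1 / 2 : ℝ) • polarR q) + (q 0 / radius q) • ((1 / radius q) • polarPhi q)

/-- The connection form `ω(X) = g(e₁, ∇_X e₂)` at `q`. -/
def connectionForm (q X : Plane) : ℝ := metricForm q (frameOne q) (covDeriv q X frameTwo)

/-- The angular form `dφ(X) = (x X² - y X¹) / r²` at `q`. -/
def angularForm (q X : Plane) : ℝ := (q 0 * X 1 - q 1 * X 0) / (q 0 ^ 2 + q 1 ^ 2)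

/-! ### Curves

A curve in `Σ` is a function `c : ℝ → Σ`, considered on `[0, 1]`. -/

/-- The coordinate expression of a curve. -/
def coords (c : ℝ → SymTraceless) (t : ℝ) : Plane := chart (c t)

/-- The velocity, in coordinates. -/
def velocity (c : ℝ → SymTraceless) (t : ℝ) : Plane := deriv (coords c) t

/-- The integrand `ω(c'(t))` of the geometric phase. -/
def phaseDensity (c : ℝ → SymTraceless) (t : ℝ) : ℝ := connectionForm (coords c t) (velocity c t)

/-- The geometric phase `θ(c) = ∫₀¹ ω(c'(t)) dt`. -/
def geometricPhase (c : ℝ → SymTraceless) : ℝ := ∫ t in (0 : ℝ)..1, phaseDensity c t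

/-- The integrand `dφ(c'(t))` of the winding number. -/
def angularSpeed (c : ℝ → SymTraceless) (t : ℝ) : ℝ := angularForm (coords c t) (velocity c t)

/-- The (possibly non-integer) winding number `W(c; 0) = (1 / 2π) ∫ dφ`. -/
def windingNumber (c : ℝ → SymTraceless) : ℝ :=
  (1 / (2 * Real.pi)) * ∫ t in (0 : ℝ)..1, angularSpeed c t

/-- `c` is piecewise smooth on `[0, 1]`: there are `0 = τ₀ < τ₁ < ... < τₙ = 1` such that `c` is
smooth on each closed interval `[τᵢ, τᵢ₊₁]`. -/
def IsPiecewiseSmooth (c : ℝ → SymTraceless) : Prop :=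
  ∃ (n : ℕ) (τ : Fin (n + 1) → ℝ), StrictMono τ ∧ τ 0 = 0 ∧ τ (Fin.last n) = 1 ∧
    ∀ i : Fin n, ContDiffOn ℝ ∞ (coords c) (Set.Icc (τ i.castSucc) (τ i.succ))

/-- `c` traverses the origin only as a smooth regular curve: whenever it is at `0` (at an interior
time), it is smooth there and has nonzero velocity.  The condition is void for curves that avoid
the origin. -/
def CrossesOriginRegularly (c : ℝ → SymTraceless) : Prop :=
  ∀ t ∈ Set.Icc (0 : ℝ) 1, c t = 0 →
    t ∈ Set.Ioo (0 : ℝ) 1 ∧ ContDiffAt ℝ ∞ (coords c) t ∧ velocity c t ≠ 0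

/-- Loops in `U ⊆ Σ` based at `p`: piecewise smooth closed curves which may go through the origin
only smoothly and with nonzero velocity. -/
structure IsLoop (U : Set SymTraceless) (p : SymTraceless) (c : ℝ → SymTraceless) : Prop where
  start : c 0 = p
  finish : c 1 = p
  inside : ∀ t ∈ Set.Icc (0 : ℝ) 1, c t ∈ U
  piecewiseSmooth : IsPiecewiseSmooth c
  regular : CrossesOriginRegularly c

/-- Smooth simple closed curves: regular, smoothly closed up (that is, `1`-periodic), and without
self-intersections. -/
structure IsSmoothSimpleClosed (c : ℝ → SymTraceless) : Prop where
  smooth : ContDiff ℝ ∞ (coords c)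
  periodic : Function.Periodic c 1
  regular : ∀ t, velocity c t ≠ 0
  simple : Set.InjOn c (Set.Ico 0 1)

/-! ### Parallel transport and holonomy -/

/-- `V` is a parallel vector field along `c`: it is continuous on `[0, 1]`, and away from the
origin it satisfies `∇_{c'} V = 0`, that is, `V' + Γ(c', V) = 0` (wherever `c` has a
velocity). -/
def IsParallelAlong (c : ℝ → SymTraceless) (V : ℝ → Plane) : Prop :=
  ContinuousOn V (Set.Icc 0 1) ∧
    ∀ t ∈ Set.Ioo (0 : ℝ) 1, c t ≠ 0 → DifferentiableAt ℝ (coords c) t →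
      HasDerivAt V (-christoffelForm (coords c t) (velocity c t) (V t)) t

/-- `T` is the parallel transport along `c` from `t = 0` to `t = 1`: the graph of `T` consists of
the pairs `(V 0, V 1)` of boundary values of parallel vector fields `V` along `c`. -/
def IsParallelTransport (c : ℝ → SymTraceless) (T : Plane ≃ₗ[ℝ] Plane) : Prop :=
  ∀ v w : Plane, T v = w ↔ ∃ V : ℝ → Plane, IsParallelAlong c V ∧ V 0 = v ∧ V 1 = w

/-- The holonomy of `U ⊆ Σ` at `p`: all parallel transports around loops in `U` based at `p`. -/
def holonomy (U : Set SymTraceless) (p : SymTraceless) : Set (Plane ≃ₗ[ℝ] Plane) :=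
  {T | ∃ c, IsLoop U p c ∧ IsParallelTransport c T}

/-- The geometric phases modulo `2π` of all loops in `U` based at `p`. -/
def phases (U : Set SymTraceless) (p : SymTraceless) : Set Real.Angle :=
  {a | ∃ c, IsLoop U p c ∧ a = (geometricPhase c : Real.Angle)}

/-- `T` is the rotation by the angle `θ` of the tangent space at `p`, measured in the reference
frame `(e₁, e₂)`. -/
def IsFrameRotation (p : SymTraceless) (θ : ℝ) (T : Plane ≃ₗ[ℝ] Plane) : Prop :=
  T (frameOne (chart p)) = Real.cos θ • frameOne (chart p) + Real.sin θ • frameTwo (chart p) ∧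
  T (frameTwo (chart p)) = -Real.sin θ • frameOne (chart p) + Real.cos θ • frameTwo (chart p)

end ConeHolonomy

end

/-!
Identify `Σ` with `ℂ` through `z = x + iy`. The reference frame at `z` depends only on the squared
direction `u = z / z̄ = e^{2iφ}`, which has a limit when a curve crosses the origin with nonzero
velocity. Hence the frame extends continuously along every loop. In frame components `w = a + ib`
the equation of parallel transport reads `w' = (i/2) φ' w`, so transport around a loop is
multiplication by `e^{iθ}`, where `θ` is half of the swept angle `∫ dφ`.

Around a loop, `u` turns by twice the swept angle and returns to its initial value, so the swept
angle is an integer multiple of `π`; if the loop avoids the origin, then `z / |z|` itself is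
continuous and the swept angle is a multiple of `2π`. Circles around the origin and circles through
the origin, run through several times, realise all these multiples.

For a smooth simple closed curve through the origin we follow Hopf's proof of the Umlaufsatz: the
chords from a point of the curve to all the others turn by an angle which does not depend on the
point. At a lowest point the chords stay in a half plane and turn from one direction of the tangent
to the opposite one, so this angle is `±π`.
-/

noncomputable section

namespace ConeHolonomy

open MeasureTheory Filter Topology Set Asymptotics Complex
open scoped ComplexConjugate Interval Matrix

/-! ### The Levi-Civita connection of the cone metric -/

theorem normSq_pos {q : Plane} (hq : q ≠ 0) : 0 < q 0 ^ 2 + q 1 ^ 2 := by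
  obtain ⟨i, hi⟩ := Function.ne_iff.1 hq
  have hi := sq_pos_of_ne_zero hi
  fin_cases i
  · exact add_pos_of_pos_of_nonneg hi (sq_nonneg _)
  · exact add_pos_of_nonneg_of_pos (sq_nonneg _) hi

theorem radius_pos {q : Plane} (hq : q ≠ 0) : 0 < radius q := Real.sqrt_pos.2 (normSq_pos hq)

theorem radius_sq (q : Plane) : radius q ^ 2 = q 0 ^ 2 + q 1 ^ 2 := Real.sq_sqrt (by positivity)

/-- The matrix `q qᵀ / r²` of the Euclidean orthogonal projection onto the radial line `ℝ q`. The
cone metric, its inverse and the frame are combinations of it and the identity. -/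
def radialProj (q : Plane) : Matrix (Fin 2) (Fin 2) ℝ :=
  (q 0 ^ 2 + q 1 ^ 2)⁻¹ • Matrix.vecMulVec q q

theorem radialProj_apply (q : Plane) (i j : Fin 2) :
    radialProj q i j = q i * q j / (q 0 ^ 2 + q 1 ^ 2) := by
  simp only [radialProj, Matrix.smul_apply, Matrix.vecMulVec_apply, smul_eq_mul]
  ring

theorem isIdempotentElem_radialProj {q : Plane} (hq : q ≠ 0) :
    IsIdempotentElem (radialProj q) := by
  have h : q ⬝ᵥ q = q 0 ^ 2 + q 1 ^ 2 := by simp only [dotProduct, Fin.sum_univ_two, sq]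
  rw [IsIdempotentElem, radialProj, smul_mul_smul_comm, Matrix.vecMulVec_mul_vecMulVec, h,
    Matrix.vecMulVec_smul, smul_smul, mul_assoc, inv_mul_cancel₀ (normSq_pos hq).ne', mul_one]

/-- The coordinate `x` (`i = 0`) or `y` (`i = 1`) as a continuous linear functional, which is also
the coordinate differential `dx` or `dy`. -/
def coordCLM (i : Fin 2) : Plane →L[ℝ] ℝ := ContinuousLinearMap.proj i

@[simp]
theorem coordCLM_apply (i : Fin 2) (q : Plane) : coordCLM i q = q i := rfl

/-- The angular form `dφ` at `q` as a continuous linear functional. -/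
def angularCLM (q : Plane) : Plane →L[ℝ] ℝ :=
  (q 0 ^ 2 + q 1 ^ 2)⁻¹ •
    (q 0 • coordCLM 1 - q 1 • coordCLM 0)

@[simp]
theorem angularCLM_apply (q X : Plane) : angularCLM q X = angularForm q X := by
  simp only [angularCLM, angularForm, smul_apply, sub_apply, coordCLM_apply,
    smul_eq_mul]
  ring

theorem hasFDerivAt_normSq (q : Plane) :
    HasFDerivAt (fun z : Plane => z 0 ^ 2 + z 1 ^ 2)
      ((2 : ℝ) • (q 0 • coordCLM 0 + q 1 • coordCLM 1)) q := by
  refine (((coordCLM 0).hasFDerivAt.pow 2).add ((coordCLM 1).hasFDerivAt.pow 2)).congr_fderiv ?_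
  ext v
  simp
  ring

theorem hasFDerivAt_radius {q : Plane} (hq : q ≠ 0) :
    HasFDerivAt radius
      ((radius q)⁻¹ • (q 0 • coordCLM 0 + q 1 • coordCLM 1)) q := by
  refine ((hasFDerivAt_normSq q).sqrt (normSq_pos hq).ne').congr_fderiv ?_
  rw [smul_smul, ← radius]
  congr 1
  field_simp

theorem hasFDerivAt_radialProj {q : Plane} (hq : q ≠ 0) (i j : Fin 2) :
    HasFDerivAt (fun z => radialProj z i j)
      (((polarPhi q i * q j + q i * polarPhi q j) / (q 0 ^ 2 + q 1 ^ 2)) • angularCLM q) q := by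
  have hn := (normSq_pos hq).ne'
  simp only [radialProj_apply]
  refine (((coordCLM i).hasFDerivAt.mul (coordCLM j).hasFDerivAt).mul
    ((hasDerivAt_inv hn).comp_hasFDerivAt q (hasFDerivAt_normSq q))).congr_fderiv ?_
  ext X
  fin_cases i <;> fin_cases j <;> simp [angularForm, polarPhi] <;> field_simp <;> ring

theorem coneJacobian_eq {q : Plane} (hq : q ≠ 0) :
    coneJacobian q = !![1, 0; 0, 1; √3 * (q 0 / radius q), √3 * (q 1 / radius q)] := by
  have h : HasFDerivAt coneMap (ContinuousLinearMap.pi ![coordCLM 0,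
      coordCLM 1, √3 • ((radius q)⁻¹ •
        (q 0 • coordCLM 0 + q 1 • coordCLM 1))]) q := by
    refine hasFDerivAt_pi.2 fun k => ?_
    fin_cases k
    · exact (coordCLM 0).hasFDerivAt
    · exact (coordCLM 1).hasFDerivAt
    · exact (hasFDerivAt_radius hq).const_mul √3
  ext k i
  rw [coneJacobian, Matrix.of_apply, h.fderiv]
  fin_cases k <;> fin_cases i <;> simp [coordVec, div_eq_inv_mul]

theorem metric_eq {q : Plane} (hq : q ≠ 0) : metric q = 1 + (3 : ℝ) • radialProj q := by
  have hr := (radius_pos hq).ne'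
  have h3 : √3 ^ 2 = (3 : ℝ) := Real.sq_sqrt (by norm_num)
  ext i j
  rw [metric, coneJacobian_eq hq, Matrix.add_apply, Matrix.smul_apply, radialProj_apply,
    ← radius_sq]
  fin_cases i <;> fin_cases j <;> simp [Matrix.mul_apply, Fin.sum_univ_three] <;> field_simp <;>
    rw [h3] <;> ring

theorem metric_inv_eq {q : Plane} (hq : q ≠ 0) :
    (metric q)⁻¹ = 1 - (3 / 4 : ℝ) • radialProj q := by
  apply Matrix.inv_eq_right_inv
  have h := (isIdempotentElem_radialProj hq).eq
  rw [metric_eq hq, add_mul, mul_sub, mul_sub, one_mul, one_mul, mul_one, smul_mul_smul_comm, h]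
  module

theorem partialDeriv_metric {q : Plane} (hq : q ≠ 0) (l i j : Fin 2) :
    partialDeriv l (fun z => metric z i j) q =
      3 * ((polarPhi q i * q j + q i * polarPhi q j) / (q 0 ^ 2 + q 1 ^ 2) *
        angularForm q (coordVec l)) := by
  have h : (fun z => metric z i j) =ᶠ[𝓝 q]
      fun z => (1 : Matrix (Fin 2) (Fin 2) ℝ) i j + 3 * radialProj z i j := by
    filter_upwards [isOpen_ne.mem_nhds hq] with z hz
    rw [metric_eq hz, Matrix.add_apply, Matrix.smul_apply, smul_eq_mul]
  rw [partialDeriv, h.fderiv_eq,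
    (((hasFDerivAt_radialProj hq i j).const_mul 3).const_add _).fderiv]
  simp only [smul_apply, angularCLM_apply, smul_eq_mul]

theorem christoffelForm_eq {q : Plane} (hq : q ≠ 0) (X Y : Plane) :
    christoffelForm q X Y = (3 / 4 * angularForm q X * angularForm q Y) • q := by
  have hn := (normSq_pos hq).ne'
  ext k
  simp only [christoffelForm, christoffel, Fin.sum_univ_two, metric_inv_eq hq,
    partialDeriv_metric hq, Matrix.sub_apply, Matrix.smul_apply, radialProj_apply, Pi.smul_apply,
    smul_eq_mul]
  fin_cases k <;> simp [angularForm, polarPhi, coordVec, Matrix.one_apply] <;> field_simp <;> ring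

/-- The matrix with columns `e₁, e₂`. -/
def frameMatrix (q : Plane) : Matrix (Fin 2) (Fin 2) ℝ := 1 - (1 / 2 : ℝ) • radialProj q

theorem frameOne_eq {q : Plane} (hq : q ≠ 0) : frameOne q = (frameMatrix q).col 0 := by
  have hr := (radius_pos hq).ne'
  have h := radius_sq q
  ext k
  rw [Matrix.col_apply, frameMatrix, Matrix.sub_apply, Matrix.smul_apply, radialProj_apply,
    ← radius_sq]
  fin_cases k <;> simp [frameOne, polarR, polarPhi, Matrix.one_apply] <;> field_simp <;>
    first | ring1 | linear_combination -2 * h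

theorem frameTwo_eq {q : Plane} (hq : q ≠ 0) : frameTwo q = (frameMatrix q).col 1 := by
  have hr := (radius_pos hq).ne'
  have h := radius_sq q
  ext k
  rw [Matrix.col_apply, frameMatrix, Matrix.sub_apply, Matrix.smul_apply, radialProj_apply,
    ← radius_sq]
  fin_cases k <;> simp [frameTwo, polarR, polarPhi, Matrix.one_apply] <;> field_simp <;>
    first | ring1 | linear_combination -2 * h

theorem fderiv_frameTwo {q : Plane} (hq : q ≠ 0) (X : Plane) (k : Fin 2) :
    fderiv ℝ frameTwo q X k = -(1 / 2) *
      ((polarPhi q k * q 1 + q k * polarPhi q 1) / (q 0 ^ 2 + q 1 ^ 2) * angularForm q X) := by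
  have h : frameTwo =ᶠ[𝓝 q] fun z k => frameMatrix z k 1 := by
    filter_upwards [isOpen_ne.mem_nhds hq] with z hz using frameTwo_eq hz
  have hd : ∀ k, HasFDerivAt (fun z => frameMatrix z k 1) _ q := fun k =>
    ((hasFDerivAt_radialProj hq k 1).const_mul (1 / 2)).const_sub
      ((1 : Matrix (Fin 2) (Fin 2) ℝ) k 1)
  rw [h.fderiv_eq, (hasFDerivAt_pi.2 hd).fderiv, ContinuousLinearMap.pi_apply, neg_apply,
    smul_apply, smul_apply, angularCLM_apply, smul_eq_mul, smul_eq_mul, neg_mul]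

theorem covDeriv_frameTwo {q : Plane} (hq : q ≠ 0) (X : Plane) :
    covDeriv q X frameTwo = (angularForm q X / 2) • frameOne q := by
  have hn := (normSq_pos hq).ne'
  ext k
  rw [covDeriv, Pi.add_apply, fderiv_frameTwo hq, christoffelForm_eq hq, frameTwo_eq hq,
    frameOne_eq hq]
  fin_cases k <;> simp [frameMatrix, radialProj_apply, angularForm, polarPhi] <;> field_simp <;>
    ring

theorem metricForm_frameOne {q : Plane} (hq : q ≠ 0) :
    metricForm q (frameOne q) (frameOne q) = 1 := by
  have hn := (normSq_pos hq).ne'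
  simp only [metricForm, Fin.sum_univ_two, metric_eq hq, frameOne_eq hq, frameMatrix,
    Matrix.col_apply, Matrix.add_apply, Matrix.sub_apply, Matrix.smul_apply, radialProj_apply,
    Matrix.one_apply, Fin.isValue, if_true, zero_ne_one, one_ne_zero, if_false, smul_eq_mul]
  field_simp
  ring

theorem metricForm_smul_right (q X Y : Plane) (a : ℝ) :
    metricForm q X (a • Y) = a * metricForm q X Y := by
  simp only [metricForm, Fin.sum_univ_two, Pi.smul_apply, smul_eq_mul]
  ring

theorem connectionForm_eq {q : Plane} (hq : q ≠ 0) (X : Plane) :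
    connectionForm q X = angularForm q X / 2 := by
  rw [connectionForm, covDeriv_frameTwo hq, metricForm_smul_right, metricForm_frameOne hq, mul_one]

/-! ### The angle swept out by a plane curve -/

/-- The square `w² / |w|²` of the direction of a nonzero `w : ℂ`, which encodes the line `ℝ w`. -/
def sqDirection (w : ℂ) : ℂ := w / conj w

theorem sqDirection_ofReal_mul {a : ℝ} (ha : a ≠ 0) (w : ℂ) :
    sqDirection (a * w) = sqDirection w := by
  rw [sqDirection, map_mul, conj_ofReal, mul_div_mul_left _ _ (ofReal_ne_zero.2 ha), sqDirection]

theorem norm_sqDirection {w : ℂ} (hw : w ≠ 0) : ‖sqDirection w‖ = 1 := by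
  rw [sqDirection, norm_div, norm_conj, div_self (norm_ne_zero_iff.2 hw)]

theorem sqDirection_eq_sq {w : ℂ} (hw : w ≠ 0) : sqDirection w = (w / ‖w‖) ^ 2 := by
  have hc : conj w ≠ 0 := (map_ne_zero _).2 hw
  have hn : (‖w‖ : ℂ) ≠ 0 := ofReal_ne_zero.2 (norm_ne_zero_iff.2 hw)
  rw [sqDirection, div_pow, div_eq_div_iff hc (pow_ne_zero 2 hn), ← mul_conj']
  ring

theorem continuousAt_sqDirection {w : ℂ} (hw : w ≠ 0) : ContinuousAt sqDirection w :=
  continuousAt_id.div continuous_conj.continuousAt ((map_ne_zero _).2 hw)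

/-- The angular velocity `dφ(z') = Im (z' / z)` about the origin of a plane curve `z`; it takes the
junk value `0` at the zeros of `z`. -/
def angularVelocity (z : ℝ → ℂ) (t : ℝ) : ℝ := (deriv z t / z t).im

/-- The angle swept out about the origin by a plane curve `z` on `[a, t]`. A passage through the
origin contributes nothing, although the direction of `z` jumps by `π` there. -/
def sweptAngle (z : ℝ → ℂ) (a t : ℝ) : ℝ := ∫ s in a..t, angularVelocity z s

/-- The squared direction of a plane curve, extended through its zeros by that of the velocity. -/
def sqDirectionAlong (z : ℝ → ℂ) (t : ℝ) : ℂ := sqDirection (if z t = 0 then deriv z t else z t)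

/-- The plane curves on `[a, b]` which sweep out a well-defined angle: piecewise `C¹` with bounded
velocity, and `C²` with nonzero velocity whenever they are at the origin. -/
structure IsRegularCurveOn (z : ℝ → ℂ) (a b : ℝ) : Prop where
  continuousOn : ContinuousOn z (Icc a b)
  finite_not_contDiffAt : {t ∈ Ioo a b | ¬ContDiffAt ℝ 1 z t}.Finite
  isBounded_deriv : Bornology.IsBounded (deriv z '' Icc a b)
  crossing : ∀ t ∈ Icc a b, z t = 0 → ContDiffAt ℝ 2 z t ∧ deriv z t ≠ 0

theorem sweptAngle_self (z : ℝ → ℂ) (a : ℝ) : sweptAngle z a a = 0 :=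
  intervalIntegral.integral_same

theorem hasDerivAt_sqDirection_comp {z : ℝ → ℂ} {t : ℝ} (hz : z t ≠ 0)
    (hd : DifferentiableAt ℝ z t) :
    HasDerivAt (fun s => sqDirection (z s))
      (2 * I * angularVelocity z t * sqDirection (z t)) t := by
  have hc : conj (z t) ≠ 0 := (map_ne_zero _).2 hz
  refine (hd.hasDerivAt.div (conjCLE.hasFDerivAt.comp_hasDerivAt t hd.hasDerivAt) hc).congr_deriv ?_
  have him : (2 * I * angularVelocity z t : ℂ) =
      deriv z t / z t - conj (deriv z t) / conj (z t) := by
    rw [← map_div₀, sub_conj, angularVelocity]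
    push_cast
    ring
  rw [him, sqDirection]
  simp only [Function.comp_apply, ContinuousLinearEquiv.coe_coe, conjCLE_apply]
  field_simp

theorem hasDerivAt_sqDirectionAlong {z : ℝ → ℂ} {t : ℝ} (hz : z t ≠ 0)
    (hd : DifferentiableAt ℝ z t) :
    HasDerivAt (sqDirectionAlong z) (2 * I * angularVelocity z t * sqDirectionAlong z t) t := by
  have h : sqDirectionAlong z =ᶠ[𝓝 t] fun s => sqDirection (z s) := by
    filter_upwards [hd.continuousAt.eventually_ne hz] with s hs
    rw [sqDirectionAlong, if_neg hs]
  rw [h.eq_of_nhds]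
  exact (hasDerivAt_sqDirection_comp hz hd).congr_of_eventuallyEq h

theorem continuousAt_sqDirectionAlong_of_eq_zero {z : ℝ → ℂ} {t : ℝ} (hz : z t = 0)
    (hd : deriv z t ≠ 0) : ContinuousAt (sqDirectionAlong z) t := by
  have hz' := differentiableAt_of_deriv_ne_zero hd
  have h : sqDirectionAlong z =ᶠ[𝓝 t] fun s => sqDirection (dslope z t s) := by
    filter_upwards [eventually_nhdsWithin_iff.1 (hz'.hasDerivAt.eventually_ne hd (c := 0))]
      with s hs
    rcases eq_or_ne s t with rfl | hst
    · rw [sqDirectionAlong, if_pos hz, dslope_same]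
    · rw [sqDirectionAlong, if_neg (hs hst), dslope_of_ne z hst, slope_def_module, hz, sub_zero,
        real_smul, sqDirection_ofReal_mul (inv_ne_zero (sub_ne_zero.2 hst))]
  refine ContinuousAt.congr ?_ h.symm
  have h0 : dslope z t t ≠ 0 := by rwa [dslope_same]
  exact ContinuousAt.comp (f := dslope z t) (continuousAt_sqDirection h0)
    (continuousAt_dslope_same.2 hz')

theorem isBigO_sub_sub_fderiv_apply {E F : Type*} [NormedAddCommGroup E]
    [NormedSpace ℝ E] [NormedAddCommGroup F] [NormedSpace ℝ F] {f : E → F} {x : E}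
    (hf : ContDiffAt ℝ 2 f x) :
    (fun y => f y - f x - fderiv ℝ f y (y - x)) =O[𝓝 x] fun y => ‖y - x‖ ^ 2 := by
  obtain ⟨K, s, hs, hK⟩ := (hf.fderiv_right (m := 1) le_rfl).exists_lipschitzOnWith
  have hd : ∀ᶠ y in 𝓝 x, DifferentiableAt ℝ f y :=
    (hf.eventually (by decide)).mono fun y hy => hy.differentiableAt two_ne_zero
  obtain ⟨δ, hδ, hball⟩ := Metric.mem_nhds_iff.1 (inter_mem hs hd)
  refine IsBigO.of_bound K ?_
  filter_upwards [Metric.ball_mem_nhds x hδ] with y hy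
  have hseg : segment ℝ y x ⊆ Metric.ball x δ :=
    (convex_ball x δ).segment_subset hy (Metric.mem_ball_self hδ)
  have hmv := (convex_segment y x).norm_image_sub_le_of_norm_fderiv_le' (f := f)
    (φ := fderiv ℝ f y) (C := K * ‖y - x‖) (fun w hw => (hball (hseg hw)).2) (fun w hw => ?_)
    (right_mem_segment ℝ y x) (left_mem_segment ℝ y x)
  · rwa [norm_pow, norm_norm, sq, ← mul_assoc]
  · refine (hK.norm_sub_le (hball (hseg hw)).1 (hball hy).1).trans ?_
    gcongr
    rw [norm_sub_rev y x]
    exact norm_sub_le_of_mem_segment hw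

/-- Since `(t - t₀)⁻¹` is real, `Im (z' / z)` is the imaginary part of
`z' / z - (t - t₀)⁻¹ = -(z - (t - t₀) z') / ((t - t₀) z)`, where numerator and denominator both are
`O((t - t₀)²)`. -/
theorem isBigO_angularVelocity_of_eq_zero {z : ℝ → ℂ} {t : ℝ} (hz : z t = 0)
    (hc : ContDiffAt ℝ 2 z t) (hd : deriv z t ≠ 0) :
    angularVelocity z =O[𝓝 t] fun _ => (1 : ℝ) := by
  have hquot : ∀ s, angularVelocity z s =
      -((z s - (s - t) * deriv z s) / ((s - t) * z s)).im := by
    intro s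
    rcases eq_or_ne s t with rfl | hst
    · simp [angularVelocity, hz]
    rcases eq_or_ne (z s) 0 with h0 | h0
    · simp [angularVelocity, h0]
    have hst' : (s : ℂ) - t ≠ 0 := sub_ne_zero.2 (ofReal_injective.ne hst)
    have hreal : (((s : ℂ) - t)⁻¹).im = 0 := by norm_cast
    rw [sub_div, mul_div_mul_left _ _ hst', mul_comm, div_mul_cancel_left₀ h0, sub_im, hreal,
      zero_sub, neg_neg, angularVelocity]
  have hnum : (fun s => z s - (s - t) * deriv z s) =O[𝓝 t] fun s => (s - t) ^ 2 := by
    refine (isBigO_sub_sub_fderiv_apply hc).congr (fun s => ?_) fun s => ?_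
    · rw [hz, sub_zero, fderiv_eq_smul_deriv, real_smul, ofReal_sub]
    · rw [Real.norm_eq_abs, sq_abs]
  have hden : (fun s => (s - t) ^ 2) =O[𝓝 t] fun s => ((s : ℂ) - t) * z s := by
    have hsub : (fun s => s - t) =O[𝓝 t] z := by
      have h := (differentiableAt_of_deriv_ne_zero hd).hasDerivAt.isTheta_sub hd
      simpa only [Function.comp_def, id_eq, hz, sub_zero] using
        h.isBigO_symm.comp_tendsto (tendsto_id.prodMk tendsto_const_pure)
    have hcast := (isTheta_ofReal (fun s => s - t) (𝓝 t)).isBigO_symm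
    simpa only [sq, ofReal_sub] using hcast.mul hsub
  have hquot_bdd := (div_isBoundedUnder_of_isBigO (hnum.trans hden)).isBigO_one ℝ
  refine (isBigO_of_le _ fun s => ?_).trans hquot_bdd
  rw [hquot, norm_neg]
  exact abs_im_le_norm _

theorem IsRegularCurveOn.isBigO_angularVelocity {z : ℝ → ℂ} {a b t : ℝ}
    (h : IsRegularCurveOn z a b) (ht : t ∈ Icc a b) :
    angularVelocity z =O[𝓝[Icc a b] t] fun _ => (1 : ℝ) := by
  rcases eq_or_ne (z t) 0 with hz | hz
  · obtain ⟨hc, hd⟩ := h.crossing t ht hz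
    exact (isBigO_angularVelocity_of_eq_zero hz hc hd).mono nhdsWithin_le_nhds
  · obtain ⟨C, hC⟩ := isBounded_iff_forall_norm_le.1 h.isBounded_deriv
    have hderiv : deriv z =O[𝓝[Icc a b] t] fun _ => (1 : ℝ) :=
      .of_bound C (eventually_mem_nhdsWithin.mono fun s hs => by
        simpa using hC _ (mem_image_of_mem _ hs))
    have hinv : (fun s => (z s)⁻¹) =O[𝓝[Icc a b] t] fun _ => (1 : ℝ) :=
      ((h.continuousOn t ht).tendsto.inv₀ hz).isBigO_one ℝ
    have hdiv : (fun s => deriv z s / z s) =O[𝓝[Icc a b] t] fun _ => (1 : ℝ) := by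
      simpa only [div_eq_mul_inv, mul_one] using hderiv.mul hinv
    exact (isBigO_of_le _ fun s => abs_im_le_norm _).trans hdiv

theorem IsRegularCurveOn.aestronglyMeasurable_angularVelocity {z : ℝ → ℂ} {a b : ℝ}
    (h : IsRegularCurveOn z a b) :
    AEStronglyMeasurable (angularVelocity z) (volume.restrict (Icc a b)) :=
  (measurable_im.comp_aemeasurable ((measurable_deriv z).aemeasurable.div
    (h.continuousOn.aemeasurable measurableSet_Icc))).aestronglyMeasurable

theorem IsRegularCurveOn.intervalIntegrable_angularVelocity {z : ℝ → ℂ} {a b : ℝ}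
    (h : IsRegularCurveOn z a b) (hab : a ≤ b) :
    IntervalIntegrable (angularVelocity z) volume a b := by
  rw [intervalIntegrable_iff_integrableOn_Icc_of_le hab]
  refine LocallyIntegrableOn.integrableOn_isCompact (fun t ht => ?_) isCompact_Icc
  exact (h.isBigO_angularVelocity ht).integrableAtFilter
    ⟨Icc a b, self_mem_nhdsWithin, h.aestronglyMeasurable_angularVelocity⟩
    ⟨Icc a b, self_mem_nhdsWithin, continuousOn_const.integrableOn_Icc⟩

theorem IsRegularCurveOn.continuousOn_sweptAngle {z : ℝ → ℂ} {a b : ℝ}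
    (h : IsRegularCurveOn z a b) (hab : a ≤ b) : ContinuousOn (sweptAngle z a) (Icc a b) := by
  have hint := h.intervalIntegrable_angularVelocity hab
  rw [← uIcc_of_le hab]
  exact intervalIntegral.continuousOn_primitive_interval' hint left_mem_uIcc

theorem IsRegularCurveOn.finite_zeros {z : ℝ → ℂ} {a b : ℝ} (h : IsRegularCurveOn z a b) :
    {t ∈ Icc a b | z t = 0}.Finite := by
  refine isCompact_Icc.induction_on (p := fun s => {t ∈ s | z t = 0}.Finite) (by simp)
    (fun s u hsu hu => hu.subset fun t ht => ⟨hsu ht.1, ht.2⟩)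
    (fun s u hs hu => (hs.union hu).subset fun t ht => ht.1.imp (⟨·, ht.2⟩) (⟨·, ht.2⟩))
    fun t ht => ?_
  suffices h1 : ∀ᶠ s in 𝓝[Icc a b] t, s ≠ t → z s ≠ 0 from
    ⟨_, h1, (finite_singleton t).subset fun s hs => not_ne_iff.1 fun hst => hs.1 hst hs.2⟩
  rcases eq_or_ne (z t) 0 with hz | hz
  · obtain ⟨-, hd⟩ := h.crossing t ht hz
    exact nhdsWithin_le_nhds (eventually_nhdsWithin_iff.1
      ((differentiableAt_of_deriv_ne_zero hd).hasDerivAt.eventually_ne hd))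
  · exact ((h.continuousOn t ht).eventually_ne hz).mono fun s hs _ => hs

theorem IsRegularCurveOn.hasDerivAt_sweptAngle_of_contDiffAt {z : ℝ → ℂ} {a b t : ℝ}
    (h : IsRegularCurveOn z a b) (ht : t ∈ Ioo a b) (hz : z t ≠ 0) (hc : ContDiffAt ℝ 1 z t) :
    HasDerivAt (sweptAngle z a) (angularVelocity z t) t := by
  have hint : IntervalIntegrable (angularVelocity z) volume a t :=
    (h.intervalIntegrable_angularVelocity (ht.1.trans ht.2).le).mono_set
      (uIcc_subset_uIcc_left (Ioo_subset_Icc_self.trans Icc_subset_uIcc ht))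
  have hcont : ContinuousAt (angularVelocity z) t := continuous_im.continuousAt.comp
    (((hc.continuousAt_fderiv one_ne_zero).clm_apply continuousAt_const).div hc.continuousAt hz)
  exact intervalIntegral.integral_hasDerivAt_right hint
    ⟨Icc a b, Icc_mem_nhds ht.1 ht.2, h.aestronglyMeasurable_angularVelocity⟩ hcont

theorem eq_of_hasDerivAt_zero_off_countable {E : Type*} [NormedAddCommGroup E] [NormedSpace ℝ E]
    [CompleteSpace E] {f : ℝ → E} {a b : ℝ} {S : Set ℝ} (hS : S.Countable)
    (hc : ContinuousOn f (Icc a b)) (hd : ∀ t ∈ Ioo a b \ S, HasDerivAt f 0 t) {t : ℝ}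
    (ht : t ∈ Icc a b) : f t = f a := by
  have h := integral_eq_of_hasDerivAt_off_countable_of_le f 0 ht.1 hS
    (hc.mono (Icc_subset_Icc_right ht.2)) (fun s hs => hd s ⟨Ioo_subset_Ioo_right ht.2 hs.1, hs.2⟩)
    intervalIntegrable_const
  simpa [eq_comm, sub_eq_zero] using h

/-- The differential equation may fail at the finitely many corners and zeros of `z`. -/
theorem IsRegularCurveOn.eq_cexp_mul_of_hasDerivAt {z : ℝ → ℂ} {a b : ℝ}
    (h : IsRegularCurveOn z a b) {κ : ℂ} {g : ℝ → ℂ} (hg : ContinuousOn g (Icc a b))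
    (hg' : ∀ t ∈ Ioo a b, z t ≠ 0 → DifferentiableAt ℝ z t →
      HasDerivAt g (κ * angularVelocity z t * g t) t) {t : ℝ} (ht : t ∈ Icc a b) :
    g t = exp (κ * sweptAngle z a t) * g a := by
  have hconst := eq_of_hasDerivAt_zero_off_countable
    (f := fun s => exp (-(κ * sweptAngle z a s)) * g s)
    (h.finite_not_contDiffAt.union h.finite_zeros).countable
    ((continuous_exp.comp_continuousOn (continuousOn_const.mul (continuous_ofReal.comp_continuousOn
      (h.continuousOn_sweptAngle (ht.1.trans ht.2)))).neg).mul hg) (fun s hs => ?_) ht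
  · simp only [sweptAngle_self, ofReal_zero, mul_zero, neg_zero, exp_zero, one_mul] at hconst
    rw [← hconst, ← mul_assoc, ← exp_add, add_neg_cancel, exp_zero, one_mul]
  · obtain ⟨hs, hS⟩ := hs
    have hz : z s ≠ 0 := fun hz => hS (.inr ⟨Ioo_subset_Icc_self hs, hz⟩)
    have hc : ContDiffAt ℝ 1 z s := not_not.1 fun hc => hS (.inl ⟨hs, hc⟩)
    have hα := (h.hasDerivAt_sweptAngle_of_contDiffAt hs hz hc).ofReal_comp
    refine ((hα.const_mul κ).neg.cexp.mul
      (hg' s hs hz (hc.differentiableAt one_ne_zero))).congr_deriv ?_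
    ring

theorem IsRegularCurveOn.continuousOn_sqDirectionAlong {z : ℝ → ℂ} {a b : ℝ}
    (h : IsRegularCurveOn z a b) : ContinuousOn (sqDirectionAlong z) (Icc a b) := by
  intro t ht
  rcases eq_or_ne (z t) 0 with hz | hz
  · exact (continuousAt_sqDirectionAlong_of_eq_zero hz
      (h.crossing t ht hz).2).continuousWithinAt
  · have hev : sqDirectionAlong z =ᶠ[𝓝[Icc a b] t] fun s => sqDirection (z s) := by
      filter_upwards [(h.continuousOn t ht).eventually_ne hz] with s hs
      rw [sqDirectionAlong, if_neg hs]
    exact ((continuousAt_sqDirection hz).comp_continuousWithinAt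
      (h.continuousOn t ht)).congr_of_eventuallyEq hev (hev.self_of_nhdsWithin ht)

theorem IsRegularCurveOn.norm_sqDirectionAlong {z : ℝ → ℂ} {a b t : ℝ}
    (h : IsRegularCurveOn z a b) (ht : t ∈ Icc a b) : ‖sqDirectionAlong z t‖ = 1 := by
  refine norm_sqDirection ?_
  split_ifs with hz
  exacts [(h.crossing t ht hz).2, hz]

theorem IsRegularCurveOn.sqDirectionAlong_eq {z : ℝ → ℂ} {a b t : ℝ}
    (h : IsRegularCurveOn z a b) (ht : t ∈ Icc a b) :
    sqDirectionAlong z t = exp (2 * I * sweptAngle z a t) * sqDirectionAlong z a :=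
  h.eq_cexp_mul_of_hasDerivAt h.continuousOn_sqDirectionAlong
    (fun _ _ hz hd => hasDerivAt_sqDirectionAlong hz hd) ht

theorem hasDerivAt_of_hasDerivAt_cexp_mul_I {f : ℝ → ℝ} {c t : ℝ} (hf : ContinuousAt f t)
    (h : HasDerivAt (fun s => exp (f s * I)) (c * I * exp (f t * I)) t) : HasDerivAt f c t := by
  have hev : f =ᶠ[𝓝 t] fun s => (log (exp (f s * I) / exp (f t * I))).im + f t := by
    have hnear : ∀ᶠ s in 𝓝 t, f s - f t ∈ Ioo (-Real.pi) Real.pi :=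
      (hf.sub continuousAt_const).eventually (Ioo_mem_nhds (by simp [Real.pi_pos])
        (by simp [Real.pi_pos]))
    filter_upwards [hnear] with s hs
    have him : ((f s - f t : ℝ) * I : ℂ).im = f s - f t := by simp
    rw [← exp_sub, ← sub_mul, ← ofReal_sub, log_exp (by rw [him]; exact hs.1)
      (by rw [him]; exact hs.2.le), him, sub_add_cancel]
  have hlog := (h.div_const (exp (f t * I))).clog_real (by
    rw [div_self (exp_ne_zero _)]; exact one_mem_slitPlane)
  rw [div_self (exp_ne_zero _), div_one, mul_div_cancel_right₀ _ (exp_ne_zero _)] at hlog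
  refine (((imCLM.hasFDerivAt.comp_hasDerivAt t hlog).add_const (f t)).congr_of_eventuallyEq
    hev).congr_deriv ?_
  simp

/-- Where `z` is merely differentiable the fundamental theorem of calculus does not apply, but the
swept angle is still half a continuous argument of the differentiable squared direction. -/
theorem IsRegularCurveOn.hasDerivAt_sweptAngle {z : ℝ → ℂ} {a b t : ℝ}
    (h : IsRegularCurveOn z a b) (ht : t ∈ Ioo a b) (hz : z t ≠ 0)
    (hd : DifferentiableAt ℝ z t) : HasDerivAt (sweptAngle z a) (angularVelocity z t) t := by
  have hab : a ≤ b := (ht.1.trans ht.2).le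
  have hnhds : Icc a b ∈ 𝓝 t := Icc_mem_nhds ht.1 ht.2
  have hcont : ContinuousAt (fun s => 2 * sweptAngle z a s) t :=
    continuousAt_const.mul ((h.continuousOn_sweptAngle hab).continuousAt hnhds)
  have hu : sqDirectionAlong z a ≠ 0 :=
    norm_ne_zero_iff.1 (by rw [h.norm_sqDirectionAlong (left_mem_Icc.2 hab)]; exact one_ne_zero)
  have hexp : ∀ s ∈ Icc a b, exp ((2 * sweptAngle z a s : ℝ) * I) =
      sqDirectionAlong z s / sqDirectionAlong z a := fun s hs => by
    rw [h.sqDirectionAlong_eq hs, mul_div_cancel_right₀ _ hu, ofReal_mul, ofReal_ofNat,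
      mul_right_comm]
  have hderiv : HasDerivAt (fun s => 2 * sweptAngle z a s) (2 * angularVelocity z t) t := by
    refine hasDerivAt_of_hasDerivAt_cexp_mul_I hcont
      ((((hasDerivAt_sqDirectionAlong hz hd).div_const (sqDirectionAlong z a)).congr_of_eventuallyEq
        (eventually_of_mem hnhds hexp)).congr_deriv ?_)
    rw [hexp t (Ioo_subset_Icc_self ht), ofReal_mul, ofReal_ofNat]
    ring
  simpa using hderiv.div_const 2

theorem IsRegularCurveOn.sweptAngle_eq_int_mul_pi {z : ℝ → ℂ} {a b : ℝ}
    (h : IsRegularCurveOn z a b) (hab : a ≤ b) (hz : z a ≠ 0) (hclosed : z b = z a) :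
    ∃ k : ℤ, sweptAngle z a b = k * Real.pi := by
  have hu : sqDirectionAlong z b = sqDirectionAlong z a := by
    rw [sqDirectionAlong, sqDirectionAlong, if_neg hz, if_neg (hclosed ▸ hz), hclosed]
  have hu0 : sqDirectionAlong z a ≠ 0 :=
    norm_ne_zero_iff.1 (by rw [h.norm_sqDirectionAlong (left_mem_Icc.2 hab)]; exact one_ne_zero)
  have hexp := h.sqDirectionAlong_eq (right_mem_Icc.2 hab)
  rw [hu, eq_comm, mul_eq_right₀ hu0, exp_eq_one_iff] at hexp
  obtain ⟨k, hk⟩ := hexp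
  refine ⟨k, ofReal_injective ?_⟩
  rw [ofReal_mul, ofReal_intCast]
  exact mul_left_cancel₀ (mul_ne_zero two_ne_zero I_ne_zero) (hk.trans (by ring))

theorem IsRegularCurveOn.div_norm_eq {z : ℝ → ℂ} {a b t : ℝ} (h : IsRegularCurveOn z a b)
    (hz : ∀ t ∈ Icc a b, z t ≠ 0) (ht : t ∈ Icc a b) :
    z t / ‖z t‖ = exp (sweptAngle z a t * I) * (z a / ‖z a‖) := by
  have hab : a ≤ b := ht.1.trans ht.2
  have hsq : ∀ s ∈ Icc a b, sqDirectionAlong z s = (z s / ‖z s‖) ^ 2 := fun s hs => by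
    rw [sqDirectionAlong, if_neg (hz s hs), sqDirection_eq_sq (hz s hs)]
  have hne : ∀ s ∈ Icc a b, z s / (‖z s‖ : ℂ) ≠ 0 := fun s hs =>
    div_ne_zero (hz s hs) (ofReal_ne_zero.2 (norm_ne_zero_iff.2 (hz s hs)))
  refine isPreconnected_Icc.eq_of_sq_eq (f := fun s => z s / (‖z s‖ : ℂ))
    (g := fun s => exp (sweptAngle z a s * I) * (z a / ‖z a‖)) ?_ ?_ (fun s hs => ?_)
    (fun _ => mul_ne_zero (exp_ne_zero _) (hne a (left_mem_Icc.2 hab))) (left_mem_Icc.2 hab)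
    ?_ ht
  · exact h.continuousOn.div (continuous_ofReal.comp_continuousOn h.continuousOn.norm)
      fun s hs => ofReal_ne_zero.2 (norm_ne_zero_iff.2 (hz s hs))
  · exact (continuous_exp.comp_continuousOn ((continuous_ofReal.comp_continuousOn
      (h.continuousOn_sweptAngle hab)).mul continuousOn_const)).mul continuousOn_const
  · rw [Pi.pow_apply, Pi.pow_apply, ← hsq s hs, h.sqDirectionAlong_eq hs,
      hsq a (left_mem_Icc.2 hab), mul_pow, ← exp_nat_mul]
    push_cast
    ring_nf
  · simp only [sweptAngle_self, ofReal_zero, zero_mul, exp_zero, one_mul]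

theorem IsRegularCurveOn.sweptAngle_eq_int_mul_two_pi {z : ℝ → ℂ} {a b : ℝ}
    (h : IsRegularCurveOn z a b) (hab : a ≤ b) (hz : ∀ t ∈ Icc a b, z t ≠ 0)
    (hclosed : z b = z a) : ∃ k : ℤ, sweptAngle z a b = k * (2 * Real.pi) := by
  have hza := hz a (left_mem_Icc.2 hab)
  have hexp := h.div_norm_eq hz (right_mem_Icc.2 hab)
  rw [hclosed, eq_comm, mul_eq_right₀ (div_ne_zero hza
    (ofReal_ne_zero.2 (norm_ne_zero_iff.2 hza))), exp_eq_one_iff] at hexp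
  obtain ⟨k, hk⟩ := hexp
  refine ⟨k, ofReal_injective (mul_right_cancel₀ I_ne_zero (hk.trans ?_))⟩
  push_cast
  ring

theorem isRegularCurveOn_of_contDiff {z : ℝ → ℂ} (hz : ContDiff ℝ 2 z)
    (hd : ∀ t, z t = 0 → deriv z t ≠ 0) (a b : ℝ) : IsRegularCurveOn z a b where
  continuousOn := hz.continuous.continuousOn
  finite_not_contDiffAt := finite_empty.subset fun _ ht =>
    ht.2 (hz.contDiffAt.of_le one_le_two)
  isBounded_deriv :=
    (isCompact_Icc.image (hz.continuous_deriv one_le_two)).isBounded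
  crossing t _ ht := ⟨hz.contDiffAt, hd t ht⟩

/-! ### Chords of simple closed curves -/

/-- `C¹` simple closed plane curves, as regular maps of period `1`. -/
structure IsSimpleClosedCurve (z : ℝ → ℂ) : Prop where
  contDiff : ContDiff ℝ 1 z
  periodic : Function.Periodic z 1
  deriv_ne_zero : ∀ t, deriv z t ≠ 0
  injOn : InjOn z (Ico 0 1)

/-- The chord `z (s + x) - z s` of a closed curve of period `1`, divided by `x (1 - x)`, in a form
that makes sense for all `s` and `x`. -/
def chordQuotient (z : ℝ → ℂ) (s x : ℝ) : ℂ :=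
  (∫ y in (0 : ℝ)..1, deriv z (s + y • x)) - ∫ y in (0 : ℝ)..1, deriv z (s + 1 + y • (x - 1))

theorem mul_integral_deriv_eq_sub {z : ℝ → ℂ} (hz : ContDiff ℝ 1 z) (s x : ℝ) :
    x * ∫ y in (0 : ℝ)..1, deriv z (s + y • x) = z (s + x) - z s := by
  have h := intervalIntegral.integral_unitInterval_deriv_eq_sub (f := z) (f' := deriv z)
    (z₀ := s) (z₁ := x) ((hz.continuous_deriv le_rfl).comp (by fun_prop)).continuousOn
    (fun t _ => (hz.differentiable one_ne_zero _).hasDerivAt)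
  rw [← h, real_smul]

theorem mul_chordQuotient {z : ℝ → ℂ} (hz : ContDiff ℝ 1 z) (hp : Function.Periodic z 1)
    (s x : ℝ) : (x * (1 - x) : ℝ) * chordQuotient z s x = z (s + x) - z s := by
  have hfrom := mul_integral_deriv_eq_sub hz s x
  have hto := mul_integral_deriv_eq_sub hz (s + 1) (x - 1)
  rw [show s + 1 + (x - 1) = s + x by ring, hp s] at hto
  push_cast at hto ⊢
  rw [chordQuotient]
  linear_combination (1 - x : ℂ) * hfrom + x * hto

theorem continuous_chordQuotient {z : ℝ → ℂ} (hz : ContDiff ℝ 1 z) :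
    Continuous fun q : ℝ × ℝ => chordQuotient z q.1 q.2 := by
  have hc := hz.continuous_deriv le_rfl
  exact (intervalIntegral.continuous_parametric_intervalIntegral_of_continuous'
      (f := fun (q : ℝ × ℝ) y => deriv z (q.1 + y • q.2)) (hc.comp (by fun_prop)) 0 1).sub
    (intervalIntegral.continuous_parametric_intervalIntegral_of_continuous'
      (f := fun (q : ℝ × ℝ) y => deriv z (q.1 + 1 + y • (q.2 - 1))) (hc.comp (by fun_prop)) 0 1)

theorem chordQuotient_zero {z : ℝ → ℂ} (hz : ContDiff ℝ 1 z) (hp : Function.Periodic z 1)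
    (s : ℝ) : chordQuotient z s 0 = deriv z s := by
  have hto := mul_integral_deriv_eq_sub hz (s + 1) (0 - 1)
  rw [show s + 1 + (0 - 1) = s by ring, hp s, sub_self, mul_eq_zero_iff_left (by norm_num)] at hto
  rw [chordQuotient, hto]
  simp

theorem chordQuotient_one {z : ℝ → ℂ} (hz : ContDiff ℝ 1 z) (hp : Function.Periodic z 1)
    (s : ℝ) : chordQuotient z s 1 = -deriv z s := by
  have hfrom := mul_integral_deriv_eq_sub hz s 1
  rw [hp s, sub_self, ofReal_one, one_mul] at hfrom
  have hper : deriv z (s + 1) = deriv z s := by rw [← deriv_comp_add_const, hp.funext]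
  rw [chordQuotient, hfrom]
  simp [hper]

theorem exists_int_sub_eq {α : Type*} {f : ℝ → α} (hp : Function.Periodic f 1)
    (hinj : InjOn f (Ico 0 1)) {s t : ℝ} (h : f s = f t) : ∃ k : ℤ, s - t = k := by
  have hfract : ∀ t : ℝ, f (Int.fract t) = f t := fun t => by
    rw [← Int.self_sub_floor, ← mul_one (⌊t⌋ : ℝ), hp.sub_int_mul_eq]
  exact Int.fract_eq_fract.1 (hinj ⟨Int.fract_nonneg _, Int.fract_lt_one _⟩
    ⟨Int.fract_nonneg _, Int.fract_lt_one _⟩ ((hfract s).trans (h.trans (hfract t).symm)))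

namespace IsSimpleClosedCurve

variable {z : ℝ → ℂ}

theorem chordQuotient_ne_zero (h : IsSimpleClosedCurve z) (s : ℝ) {x : ℝ}
    (hx : x ∈ Icc (0 : ℝ) 1) : chordQuotient z s x ≠ 0 := by
  rcases eq_or_lt_of_le hx.1 with rfl | hx0
  · rw [chordQuotient_zero h.contDiff h.periodic]
    exact h.deriv_ne_zero s
  rcases eq_or_lt_of_le hx.2 with rfl | hx1
  · rw [chordQuotient_one h.contDiff h.periodic]
    exact neg_ne_zero.2 (h.deriv_ne_zero s)
  intro hzero
  have hchord := mul_chordQuotient h.contDiff h.periodic s x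
  rw [hzero, mul_zero, eq_comm, sub_eq_zero] at hchord
  obtain ⟨k, hk⟩ := exists_int_sub_eq h.periodic h.injOn hchord
  rw [add_sub_cancel_left] at hk
  rw [hk] at hx0 hx1
  norm_cast at hx0 hx1
  omega

theorem exists_im_minimal (h : IsSimpleClosedCurve z) : ∃ m, ∀ t, (z m).im ≤ (z t).im := by
  have hp : Function.Periodic (fun t => (z t).im) 1 := h.periodic.comp im
  obtain ⟨_, ⟨m, rfl⟩, hm⟩ := (hp.compact_of_continuous one_ne_zero
    (continuous_im.comp h.contDiff.continuous)).exists_isLeast (range_nonempty _)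
  exact ⟨m, fun t => hm (mem_range_self t)⟩

theorem chordQuotient_im_nonneg (h : IsSimpleClosedCurve z) {m : ℝ}
    (hm : ∀ t, (z m).im ≤ (z t).im) {x : ℝ} (hx : x ∈ Icc (0 : ℝ) 1) :
    0 ≤ (chordQuotient z m x).im := by
  have hcrit : (deriv z m).im = 0 :=
    IsLocalMin.hasDerivAt_eq_zero (Eventually.of_forall hm)
      (imCLM.hasFDerivAt.comp_hasDerivAt m (h.contDiff.differentiable one_ne_zero m).hasDerivAt)
  rcases eq_or_lt_of_le hx.1 with rfl | hx0
  · rw [chordQuotient_zero h.contDiff h.periodic, hcrit]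
  rcases eq_or_lt_of_le hx.2 with rfl | hx1
  · rw [chordQuotient_one h.contDiff h.periodic, neg_im, hcrit, neg_zero]
  have hchord := congrArg im (mul_chordQuotient h.contDiff h.periodic m x)
  rw [im_ofReal_mul, sub_im] at hchord
  refine nonneg_of_mul_nonneg_right ?_ (mul_pos hx0 (sub_pos.2 hx1))
  rw [hchord]
  exact sub_nonneg.2 (hm _)

end IsSimpleClosedCurve

theorem sub_eq_sub_of_exp_eq {X : Type*} [TopologicalSpace X] {S : Set X} (hS : IsPreconnected S)
    {l l' : X → ℂ} (hl : ContinuousOn l S) (hl' : ContinuousOn l' S)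
    (h : ∀ x ∈ S, exp (l x) = exp (l' x)) {x y : X} (hx : x ∈ S) (hy : y ∈ S) :
    l x - l y = l' x - l' y := by
  have hdiscrete : IsDiscrete (exp ⁻¹' {1}) :=
    ⟨(isCoveringMapOn_exp 1 one_ne_zero).discreteTopology_fiber⟩
  have hconst := hS.constant_of_mapsTo hdiscrete (hl.sub hl') (fun w hw => ?_) hx hy
  · exact sub_eq_sub_iff_sub_eq_sub.1 hconst
  · simp [exp_sub, h w hw]

/-- On the closed upper half plane `w ↦ log (-I * w)` is a continuous logarithm, up to a
constant. -/
theorem sub_eq_pi_mul_I_or_of_exp_im_nonneg {X : Type*} [TopologicalSpace X] {S : Set X}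
    (hS : IsPreconnected S) {l : X → ℂ} (hl : ContinuousOn l S)
    (him : ∀ x ∈ S, 0 ≤ (exp (l x)).im) {x y : X} (hx : x ∈ S) (hy : y ∈ S)
    (hopp : exp (l y) = -exp (l x)) : l y - l x = Real.pi * I ∨ l y - l x = -(Real.pi * I) := by
  have hslit : ∀ w ∈ S, -I * exp (l w) ∈ slitPlane := fun w hw => by
    rw [mem_slitPlane_iff]
    by_contra! hcon
    obtain ⟨hre, him0⟩ := hcon
    simp only [neg_mul, neg_re, neg_im, I_mul_re, I_mul_im, neg_neg, neg_eq_zero] at hre him0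
    exact exp_ne_zero (l w) (Complex.ext him0 (hre.antisymm (him w hw)))
  have hlog := sub_eq_sub_of_exp_eq hS (l' := fun w => log (-I * exp (l w)) + log I) hl
    (((continuousOn_const.mul (continuous_exp.comp_continuousOn hl)).clog hslit).add
      continuousOn_const)
    (fun w hw => by
      rw [exp_add, exp_log (slitPlane_ne_zero (hslit w hw)), exp_log I_ne_zero]
      linear_combination exp (l w) * I_mul_I) hy hx
  obtain ⟨d, hd⟩ : ∃ d : ℝ, exp (l x) = d := ⟨(exp (l x)).re, Complex.ext rfl (by
    have hxy := him y hy
    rw [hopp, neg_im] at hxy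
    exact (neg_nonneg.1 hxy).antisymm (him x hx))⟩
  have hd0 : d ≠ 0 := by
    rintro rfl
    exact exp_ne_zero _ hd
  rw [hlog, hopp, hd]
  rcases hd0.lt_or_gt with hneg | hpos
  · right
    rw [show -I * -(d : ℂ) = (-d : ℝ) * -I by push_cast; ring,
      show -I * (d : ℂ) = (-d : ℝ) * I by push_cast; ring,
      log_ofReal_mul (neg_pos.2 hneg) (neg_ne_zero.2 I_ne_zero),
      log_ofReal_mul (neg_pos.2 hneg) I_ne_zero, log_I, log_neg_I]
    ring
  · left
    rw [show -I * -(d : ℂ) = d * I by ring, show -I * (d : ℂ) = d * -I by ring,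
      log_ofReal_mul hpos (neg_ne_zero.2 I_ne_zero), log_ofReal_mul hpos I_ne_zero, log_I,
      log_neg_I]
    ring

namespace IsSimpleClosedCurve

variable {z : ℝ → ℂ}

theorem exists_continuous_log_chordQuotient (h : IsSimpleClosedCurve z) :
    ∃ l : ℝ × ℝ → ℂ, Continuous l ∧
      ∀ s, ∀ x ∈ Icc (0 : ℝ) 1, exp (l (s, x)) = chordQuotient z s x := by
  let F : C(ℝ × ℝ, ℂ) := ⟨fun q => chordQuotient z q.1 (projIcc (0 : ℝ) 1 zero_le_one q.2),
    (continuous_chordQuotient h.contDiff).comp (f := fun q : ℝ × ℝ =>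
      (q.1, (projIcc (0 : ℝ) 1 zero_le_one q.2 : ℝ))) (continuous_fst.prodMk
        (continuous_subtype_val.comp (continuous_projIcc.comp continuous_snd)))⟩
  have hF : ∀ q, F q ∈ ({0}ᶜ : Set ℂ) := fun q =>
    h.chordQuotient_ne_zero _ (projIcc (0 : ℝ) 1 zero_le_one q.2).2
  obtain ⟨l, ⟨-, hl⟩, -⟩ := isCoveringMapOn_exp.existsUnique_continuousMap_lifts F
    (a₀ := (0, 0)) (e₀ := log (F (0, 0))) (exp_log (hF _)) hF
  refine ⟨l, l.continuous, fun s x hx => (congrFun hl (s, x)).trans ?_⟩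
  change chordQuotient z s (projIcc (0 : ℝ) 1 zero_le_one x) = _
  rw [projIcc_of_mem zero_le_one hx]

/-- Hopf's argument: the chords from `z s` turn by an angle that does not depend on `s`, and the
chords from a lowest point of the curve stay in a half plane. -/
theorem exists_log_chordQuotient (h : IsSimpleClosedCurve z) (s : ℝ) :
    ∃ l : ℝ → ℂ, Continuous l ∧ (∀ x ∈ Icc (0 : ℝ) 1, exp (l x) = chordQuotient z s x) ∧
      (l 1 - l 0 = Real.pi * I ∨ l 1 - l 0 = -(Real.pi * I)) := by
  obtain ⟨l, hlc, hexp⟩ := h.exists_continuous_log_chordQuotient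
  obtain ⟨m, hm⟩ := h.exists_im_minimal
  have hopp : ∀ r, exp (l (r, 1)) = -exp (l (r, 0)) := fun r => by
    rw [hexp r 1 unitInterval.one_mem, hexp r 0 unitInterval.zero_mem,
      chordQuotient_one h.contDiff h.periodic, chordQuotient_zero h.contDiff h.periodic]
  have hindep : l (s, 1) - l (s, 0) = l (m, 1) - l (m, 0) := by
    have hconst := sub_eq_sub_of_exp_eq isPreconnected_univ
      (l := fun r => l (r, 1) - l (r, 0)) (l' := fun _ => Real.pi * I)
      (by fun_prop) continuousOn_const (fun r _ => ?_) (mem_univ s) (mem_univ m)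
    · rwa [sub_self, sub_eq_zero] at hconst
    · rw [exp_sub, hopp, exp_pi_mul_I, neg_div, div_self (exp_ne_zero _)]
  refine ⟨fun x => l (s, x), by fun_prop, hexp s, ?_⟩
  rw [hindep]
  exact sub_eq_pi_mul_I_or_of_exp_im_nonneg isPreconnected_Icc (l := fun x => l (m, x))
    (by fun_prop) (fun x hx => (hexp m x hx).symm ▸ h.chordQuotient_im_nonneg hm hx)
    unitInterval.zero_mem unitInterval.one_mem (hopp m)

theorem sqDirectionAlong_eq_sqDirection_chordQuotient (h : IsSimpleClosedCurve z) {s x : ℝ}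
    (hs : z s = 0) (hx : x ∈ Icc (0 : ℝ) 1) :
    sqDirectionAlong z (s + x) = sqDirection (chordQuotient z s x) := by
  rcases eq_or_lt_of_le hx.1 with rfl | hx0
  · rw [add_zero, sqDirectionAlong, if_pos hs, chordQuotient_zero h.contDiff h.periodic]
  rcases eq_or_lt_of_le hx.2 with rfl | hx1
  · have hneg : -deriv z s = (-1 : ℝ) * deriv z s := by rw [ofReal_neg, ofReal_one, neg_one_mul]
    rw [sqDirectionAlong, h.periodic, if_pos hs, chordQuotient_one h.contDiff h.periodic, hneg,
      sqDirection_ofReal_mul (neg_ne_zero.2 one_ne_zero), ← deriv_comp_add_const,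
      h.periodic.funext]
  have hpos : x * (1 - x) ≠ 0 := (mul_pos hx0 (sub_pos.2 hx1)).ne'
  have hchord := mul_chordQuotient h.contDiff h.periodic s x
  rw [hs, sub_zero] at hchord
  rw [sqDirectionAlong, ← hchord, if_neg (mul_ne_zero (ofReal_ne_zero.2 hpos)
    (h.chordQuotient_ne_zero s hx)), sqDirection_ofReal_mul hpos]

end IsSimpleClosedCurve

theorem sqDirection_exp (w : ℂ) : sqDirection (exp w) = exp (2 * I * w.im) := by
  rw [sqDirection, ← exp_conj, ← exp_sub, sub_conj]
  push_cast
  ring_nf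

theorem IsSimpleClosedCurve.sweptAngle_eq_pi_or {z : ℝ → ℂ} (h : IsSimpleClosedCurve z) {s : ℝ}
    (hs : z s = 0) (hreg : IsRegularCurveOn z s (s + 1)) :
    sweptAngle z s (s + 1) = Real.pi ∨ sweptAngle z s (s + 1) = -Real.pi := by
  obtain ⟨l, hlc, hexp, hturn⟩ := h.exists_log_chordQuotient s
  have hmaps : MapsTo (s + ·) (Icc (0 : ℝ) 1) (Icc s (s + 1)) := fun x hx =>
    ⟨le_add_of_nonneg_right hx.1, add_le_add_right hx.2 s⟩
  have hangle := (hreg.continuousOn_sweptAngle (le_add_of_nonneg_right zero_le_one)).comp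
    (by fun_prop) hmaps
  have hsq : ∀ x ∈ Icc (0 : ℝ) 1, sqDirectionAlong z (s + x) = exp (2 * I * (l x).im) :=
    fun x hx => by
      rw [h.sqDirectionAlong_eq_sqDirection_chordQuotient hs hx, ← hexp x hx, sqDirection_exp]
  have hdiff := sub_eq_sub_of_exp_eq isPreconnected_Icc
    (l := fun x => 2 * I * (l x).im)
    (l' := fun x => 2 * I * sweptAngle z s (s + x) + 2 * I * (l 0).im) (by fun_prop)
    ((continuousOn_const.mul (continuous_ofReal.comp_continuousOn hangle)).add continuousOn_const)
    (fun x hx => by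
      have h0 := hsq 0 unitInterval.zero_mem
      rw [add_zero] at h0
      rw [exp_add, ← hsq x hx, ← h0, hreg.sqDirectionAlong_eq (hmaps hx)])
    unitInterval.one_mem unitInterval.zero_mem
  have him : (l 1 - l 0).im = sweptAngle z s (s + 1) := by
    rw [add_zero, sweptAngle_self, ofReal_zero, mul_zero, zero_add, add_sub_cancel_right,
      ← mul_sub, ← ofReal_sub] at hdiff
    exact ofReal_injective (mul_left_cancel₀ (mul_ne_zero two_ne_zero I_ne_zero) hdiff)
  rw [← him]
  exact hturn.imp (fun e => by rw [e, im_ofReal_mul, I_im, mul_one]) fun e => by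
    rw [e, neg_im, im_ofReal_mul, I_im, mul_one]

/-! ### Curves in `Σ` -/

/-- The identification `(x, y) ↦ x + iy` of the coordinate plane with `ℂ`. -/
def toComplex : Plane ≃L[ℝ] ℂ := Complex.basisOneI.equivFunL.symm

theorem toComplex_apply (q : Plane) : toComplex q = q 0 + q 1 * I := by
  refine (basisOneI.equivFun_symm_apply q).trans ?_
  simp

@[simp]
theorem toComplex_re (q : Plane) : (toComplex q).re = q 0 := by simp [toComplex_apply]

@[simp]
theorem toComplex_im (q : Plane) : (toComplex q).im = q 1 := by simp [toComplex_apply]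

theorem toComplex_ne_zero {q : Plane} : toComplex q ≠ 0 ↔ q ≠ 0 := toComplex.map_eq_zero_iff.not

theorem toComplex_chart_ne_zero {p : SymTraceless} : toComplex (chart p) ≠ 0 ↔ p ≠ 0 :=
  toComplex_ne_zero.trans chart.map_eq_zero_iff.not

theorem angularForm_eq_im (q X : Plane) : angularForm q X = (toComplex X / toComplex q).im := by
  rw [angularForm, div_im, normSq_apply]
  simp only [toComplex_re, toComplex_im]
  ring

/-- The curve `c`, read in the complex coordinate `x + iy` of `Σ`. -/
def complexCurve (c : ℝ → SymTraceless) (t : ℝ) : ℂ := toComplex (coords c t)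

section

variable {c : ℝ → SymTraceless} {t : ℝ}

theorem complexCurve_eq_zero : complexCurve c t = 0 ↔ c t = 0 :=
  toComplex.map_eq_zero_iff.trans chart.map_eq_zero_iff

theorem complexCurve_eq_iff {s : ℝ} : complexCurve c s = complexCurve c t ↔ c s = c t :=
  toComplex.injective.eq_iff.trans chart.injective.eq_iff

theorem differentiableAt_complexCurve :
    DifferentiableAt ℝ (complexCurve c) t ↔ DifferentiableAt ℝ (coords c) t :=
  toComplex.comp_differentiableAt_iff

theorem deriv_complexCurve (c : ℝ → SymTraceless) (t : ℝ) :
    deriv (complexCurve c) t = toComplex (velocity c t) :=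
  congrArg (fun L : ℝ →L[ℝ] ℂ => L 1) (toComplex.comp_fderiv (f := coords c) (x := t))

theorem deriv_complexCurve_ne_zero : deriv (complexCurve c) t ≠ 0 ↔ velocity c t ≠ 0 := by
  rw [deriv_complexCurve, toComplex_ne_zero]

theorem angularSpeed_eq (c : ℝ → SymTraceless) :
    angularSpeed c = angularVelocity (complexCurve c) := by
  ext1 t
  rw [angularSpeed, angularForm_eq_im, angularVelocity, deriv_complexCurve, complexCurve]

theorem windingNumber_eq (c : ℝ → SymTraceless) :
    windingNumber c = sweptAngle (complexCurve c) 0 1 / (2 * Real.pi) := by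
  rw [windingNumber, angularSpeed_eq, sweptAngle, one_div_mul_eq_div]

end

/-! ### Geometric phase and winding number -/

section

variable {c : ℝ → SymTraceless} (h : IsRegularCurveOn (complexCurve c) 0 1)

include h

theorem intervalIntegrable_angularSpeed : IntervalIntegrable (angularSpeed c) volume 0 1 := by
  rw [angularSpeed_eq]
  exact h.intervalIntegrable_angularVelocity zero_le_one

theorem phaseDensity_ae_eq : ∀ᵐ t, t ∈ Ι (0 : ℝ) 1 → phaseDensity c t = angularSpeed c t / 2 := by
  filter_upwards [measure_eq_zero_iff_ae_notMem.1 (h.finite_zeros.measure_zero volume)]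
    with t ht htI
  rw [uIoc_of_le zero_le_one] at htI
  refine connectionForm_eq (toComplex_ne_zero.1 fun h0 => ht ⟨Ioc_subset_Icc_self htI, h0⟩) _

theorem intervalIntegrable_phaseDensity : IntervalIntegrable (phaseDensity c) volume 0 1 := by
  refine ((intervalIntegrable_angularSpeed h).div_const 2).congr_ae ?_
  rw [EventuallyEq, ae_restrict_iff' measurableSet_uIoc]
  filter_upwards [phaseDensity_ae_eq h] with t ht htI using (ht htI).symm

theorem geometricPhase_eq : geometricPhase c = sweptAngle (complexCurve c) 0 1 / 2 := by
  rw [geometricPhase, intervalIntegral.integral_congr_ae (phaseDensity_ae_eq h),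
    intervalIntegral.integral_div, angularSpeed_eq, sweptAngle]

theorem geometricPhase_eq_pi_mul : geometricPhase c = Real.pi * windingNumber c := by
  rw [geometricPhase_eq h, windingNumber_eq]
  field_simp

end

/-! ### Loops -/

theorem Icc_subset_iUnion_Icc {α : Type*} [LinearOrder α] {n : ℕ} (hn : n ≠ 0)
    (τ : Fin (n + 1) → α) :
    Icc (τ 0) (τ (Fin.last n)) ⊆ ⋃ i : Fin n, Icc (τ i.castSucc) (τ i.succ) := by
  rintro t ⟨h0, h1⟩
  have hcover (j : Fin (n + 1)) (hj : j ≠ 0) (hjt : t ≤ τ j) :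
      t ∈ ⋃ i : Fin n, Icc (τ i.castSucc) (τ i.succ) := by
    induction j using Fin.induction with
    | zero => exact absurd rfl hj
    | succ i ih =>
      rcases le_or_gt (τ i.castSucc) t with hi | hi
      · exact mem_iUnion.2 ⟨i, hi, hjt⟩
      · exact ih (fun h => hi.not_ge (h ▸ h0)) hi.le
  exact hcover _ (Fin.last_eq_zero_iff.not.2 hn) h1

section

variable {E : Type*} [NormedAddCommGroup E] [NormedSpace ℝ E] {f : ℝ → E} {n : ℕ}
  {τ : Fin (n + 1) → ℝ}

theorem setOf_not_contDiffAt_subset_range (hn : n ≠ 0) {m : WithTop ℕ∞}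
    (hf : ∀ i : Fin n, ContDiffOn ℝ m f (Icc (τ i.castSucc) (τ i.succ))) :
    {t ∈ Icc (τ 0) (τ (Fin.last n)) | ¬ContDiffAt ℝ m f t} ⊆ range τ := by
  rintro t ⟨ht, hsmooth⟩
  obtain ⟨i, hi⟩ := mem_iUnion.1 (Icc_subset_iUnion_Icc hn τ ht)
  by_contra hτ
  exact hsmooth ((hf i).contDiffAt (Icc_mem_nhds (hi.1.lt_of_ne fun h => hτ ⟨_, h⟩)
    (hi.2.lt_of_ne fun h => hτ ⟨_, h.symm⟩)))

theorem isBounded_deriv_of_pieces (hn : n ≠ 0) (hτ : StrictMono τ)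
    (hf : ∀ i : Fin n, ContDiffOn ℝ 1 f (Icc (τ i.castSucc) (τ i.succ))) :
    Bornology.IsBounded (deriv f '' Icc (τ 0) (τ (Fin.last n))) := by
  have hpiece (i : Fin n) : Bornology.IsBounded
      (derivWithin f (Icc (τ i.castSucc) (τ i.succ)) '' Icc (τ i.castSucc) (τ i.succ)) :=
    (isCompact_Icc.image_of_continuousOn ((hf i).continuousOn_derivWithin
      (uniqueDiffOn_Icc (hτ Fin.castSucc_lt_succ)) le_rfl)).isBounded
  refine (((finite_range τ).image (deriv f)).isBounded.union
    (Bornology.isBounded_iUnion.2 hpiece)).subset ?_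
  rintro _ ⟨t, ht, rfl⟩
  by_cases hr : t ∈ range τ
  · exact Or.inl (mem_image_of_mem _ hr)
  · obtain ⟨i, hi⟩ := mem_iUnion.1 (Icc_subset_iUnion_Icc hn τ ht)
    have hnhds : Icc (τ i.castSucc) (τ i.succ) ∈ 𝓝 t :=
      Icc_mem_nhds (hi.1.lt_of_ne fun h => hr ⟨_, h⟩) (hi.2.lt_of_ne fun h => hr ⟨_, h.symm⟩)
    exact Or.inr (mem_iUnion.2 ⟨i, t, hi, derivWithin_of_mem_nhds hnhds⟩)

end

theorem IsLoop.isRegularCurveOn {U : Set SymTraceless} {p : SymTraceless}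
    {c : ℝ → SymTraceless} (h : IsLoop U p c) : IsRegularCurveOn (complexCurve c) 0 1 := by
  obtain ⟨n, τ, hτ, h0, h1, hs⟩ := h.piecewiseSmooth
  have hn : n ≠ 0 := by
    rintro rfl
    exact zero_ne_one (h0.symm.trans h1)
  have hs' (i : Fin n) : ContDiffOn ℝ 1 (complexCurve c) (Icc (τ i.castSucc) (τ i.succ)) :=
    toComplex.contDiff.comp_contDiffOn ((hs i).of_le (by simp))
  rw [← h0, ← h1]
  refine ⟨((locallyFinite_of_finite _).continuousOn_iUnion (fun _ => isClosed_Icc)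
      fun i => (hs' i).continuousOn).mono (Icc_subset_iUnion_Icc hn τ),
    (finite_range τ).subset ((inter_subset_inter_left _ Ioo_subset_Icc_self).trans
      (setOf_not_contDiffAt_subset_range hn hs')), isBounded_deriv_of_pieces hn hτ hs', ?_⟩
  rw [h0, h1]
  intro t ht hz
  obtain ⟨-, hsmooth, hd⟩ := h.regular t ht (complexCurve_eq_zero.1 hz)
  exact ⟨(toComplex.contDiff.contDiffAt.comp t hsmooth).of_le ENat.LEInfty.out,
    deriv_complexCurve_ne_zero.2 hd⟩

theorem isLoop_of_contDiff {U : Set SymTraceless} {p : SymTraceless} (hp : p ≠ 0)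
    {c : ℝ → SymTraceless} (hc : ContDiff ℝ ∞ (coords c)) (h0 : c 0 = p) (h1 : c 1 = p)
    (hU : ∀ t, c t ∈ U) (hreg : ∀ t, c t = 0 → velocity c t ≠ 0) : IsLoop U p c where
  start := h0
  finish := h1
  inside t _ := hU t
  piecewiseSmooth :=
    ⟨1, ![0, 1], Fin.strictMono_iff_lt_succ.2 (by simp), rfl, rfl, fun _ => hc.contDiffOn⟩
  regular t ht hz := by
    refine ⟨⟨lt_of_le_of_ne ht.1 ?_, lt_of_le_of_ne ht.2 ?_⟩, hc.contDiffAt, hreg t hz⟩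
    · rintro rfl
      exact hp (h0.symm.trans hz)
    · rintro rfl
      exact hp (h1.symm.trans hz)

theorem IsLoop.exists_geometricPhase_eq_int_mul {p : SymTraceless} (hp : p ≠ 0)
    {c : ℝ → SymTraceless} (h : IsLoop univ p c) :
    ∃ k : ℤ, geometricPhase c = k * (Real.pi / 2) := by
  obtain ⟨k, hk⟩ := h.isRegularCurveOn.sweptAngle_eq_int_mul_pi zero_le_one
    (complexCurve_eq_zero.not.2 (h.start.symm ▸ hp))
    (complexCurve_eq_iff.2 (h.finish.trans h.start.symm))
  exact ⟨k, by rw [geometricPhase_eq h.isRegularCurveOn, hk]; ring⟩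

theorem IsLoop.exists_geometricPhase_eq_int_mul_of_compl {p : SymTraceless}
    {c : ℝ → SymTraceless} (h : IsLoop {0}ᶜ p c) :
    ∃ k : ℤ, geometricPhase c = k * Real.pi := by
  obtain ⟨k, hk⟩ := h.isRegularCurveOn.sweptAngle_eq_int_mul_two_pi zero_le_one
    (fun t ht => complexCurve_eq_zero.not.2 (h.inside t ht))
    (complexCurve_eq_iff.2 (h.finish.trans h.start.symm))
  exact ⟨k, by rw [geometricPhase_eq h.isRegularCurveOn, hk]; ring⟩

/-! ### Smooth simple closed curves -/

namespace IsSmoothSimpleClosed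

variable {c : ℝ → SymTraceless} (h : IsSmoothSimpleClosed c)

include h

theorem isLoop (h0 : c 0 ≠ 0) : IsLoop univ (c 0) c :=
  isLoop_of_contDiff h0 h.smooth rfl h.periodic.eq (fun _ => mem_univ _) fun t _ => h.regular t

theorem isSimpleClosedCurve : IsSimpleClosedCurve (complexCurve c) where
  contDiff := toComplex.contDiff.comp (h.smooth.of_le (by simp))
  periodic t := complexCurve_eq_iff.2 (h.periodic t)
  deriv_ne_zero t := deriv_complexCurve_ne_zero.2 (h.regular t)
  injOn _ hs _ ht hst := h.simple hs ht (complexCurve_eq_iff.1 hst)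

theorem isRegularCurveOn (a b : ℝ) : IsRegularCurveOn (complexCurve c) a b :=
  isRegularCurveOn_of_contDiff (toComplex.contDiff.comp (h.smooth.of_le ENat.LEInfty.out))
    (fun t _ => deriv_complexCurve_ne_zero.2 (h.regular t)) a b

theorem windingNumber_and_geometricPhase (h0 : ∃ s, c s = 0) :
    (windingNumber c = 1 / 2 ∧ geometricPhase c = Real.pi / 2) ∨
      (windingNumber c = -(1 / 2) ∧ geometricPhase c = -(Real.pi / 2)) := by
  obtain ⟨s, hs⟩ := h0
  have hper : Function.Periodic (angularVelocity (complexCurve c)) 1 := fun t => by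
    have hz := h.isSimpleClosedCurve.periodic
    rw [angularVelocity, ← deriv_comp_add_const, hz.funext, hz t, angularVelocity]
  have hshift : sweptAngle (complexCurve c) 0 1 = sweptAngle (complexCurve c) s (s + 1) := by
    simpa only [sweptAngle, zero_add] using hper.intervalIntegral_add_eq 0 s
  rw [geometricPhase_eq (h.isRegularCurveOn 0 1), windingNumber_eq, hshift]
  rcases h.isSimpleClosedCurve.sweptAngle_eq_pi_or (complexCurve_eq_zero.2 hs)
    (h.isRegularCurveOn s (s + 1)) with hπ | hπ <;> rw [hπ]
  · left
    constructor <;> field_simp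
  · right
    constructor <;> field_simp

end IsSmoothSimpleClosed

/-! ### Rotations in the reference frame -/

/-- The vector with components `w.re, w.im` in the reference frame, which only depends on the
squared direction `u` of the base point. -/
def frameMap (u w : ℂ) : ℂ := (3 * w - u * conj w) / 4

/-- The components `a + ib` in the reference frame of the vector `v`, at a base point with squared
direction `u`. -/
def coframeMap (u v : ℂ) : ℂ := (3 * v + u * conj v) / 2

theorem mul_conj_eq_one {u : ℂ} (hu : ‖u‖ = 1) : u * conj u = 1 := by
  rw [mul_conj', hu, ofReal_one, one_pow]

theorem coframeMap_frameMap {u : ℂ} (hu : ‖u‖ = 1) (w : ℂ) :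
    coframeMap u (frameMap u w) = w := by
  simp only [coframeMap, frameMap, map_div₀, map_sub, map_mul, conj_conj, map_ofNat]
  linear_combination (-w / 8) * mul_conj_eq_one hu

theorem frameMap_coframeMap {u : ℂ} (hu : ‖u‖ = 1) (v : ℂ) :
    frameMap u (coframeMap u v) = v := by
  simp only [coframeMap, frameMap, map_div₀, map_add, map_mul, conj_conj, map_ofNat]
  linear_combination (-v / 8) * mul_conj_eq_one hu

theorem toComplex_frameMatrix_mulVec {q : Plane} (hq : q ≠ 0) (v : Plane) :
    toComplex (frameMatrix q *ᵥ v) = frameMap (sqDirection (toComplex q)) (toComplex v) := by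
  have hz := toComplex_ne_zero.2 hq
  have hzc : conj (toComplex q) ≠ 0 := (map_ne_zero _).2 hz
  have hmul : frameMatrix q *ᵥ v =
      v - (1 / 2 : ℝ) • ((q 0 ^ 2 + q 1 ^ 2)⁻¹ • (q ⬝ᵥ v) • q) := by
    rw [frameMatrix, radialProj, Matrix.sub_mulVec, Matrix.one_mulVec, Matrix.smul_mulVec,
      Matrix.smul_mulVec, Matrix.vecMulVec_mulVec, op_smul_eq_smul]
  have hdot : ((q ⬝ᵥ v : ℝ) : ℂ) =
      (toComplex q * conj (toComplex v) + toComplex v * conj (toComplex q)) / 2 := by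
    rw [← conj_conj (toComplex v * conj (toComplex q)), map_mul, conj_conj,
      mul_comm (conj (toComplex v)), add_conj, dotProduct, Fin.sum_univ_two]
    simp
  have hnorm : ((q 0 ^ 2 + q 1 ^ 2 : ℝ) : ℂ) = toComplex q * conj (toComplex q) := by
    rw [mul_conj, normSq_apply, toComplex_re, toComplex_im, sq, sq]
  rw [hmul, map_sub, map_smul, map_smul, map_smul, real_smul, real_smul, real_smul, hdot,
    ofReal_inv, hnorm, frameMap, sqDirection]
  push_cast
  field_simp
  ring

section

variable {q : Plane} (hq : q ≠ 0)

/-- The isomorphism `ℂ ≃ ℝ²` which sends `1, i` to the reference frame `e₁, e₂` at `q`. -/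
def frameEquiv : ℂ ≃ₗ[ℝ] Plane where
  toFun w := toComplex.symm (frameMap (sqDirection (toComplex q)) w)
  invFun v := coframeMap (sqDirection (toComplex q)) (toComplex v)
  map_add' v w := by
    rw [← map_add, frameMap, frameMap, frameMap, map_add]
    ring_nf
  map_smul' a w := by
    rw [RingHom.id_apply, ← map_smul]
    simp only [frameMap, real_smul, map_mul, conj_ofReal]
    ring_nf
  left_inv w := by
    simp only [toComplex.apply_symm_apply,
      coframeMap_frameMap (norm_sqDirection (toComplex_ne_zero.2 hq))]
  right_inv v := by
    simp only [frameMap_coframeMap (norm_sqDirection (toComplex_ne_zero.2 hq)),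
      toComplex.symm_apply_apply]

theorem frameEquiv_toComplex (v : Plane) : frameEquiv hq (toComplex v) = frameMatrix q *ᵥ v := by
  apply toComplex.injective
  rw [toComplex_frameMatrix_mulVec hq]
  exact toComplex.apply_symm_apply _

theorem frameEquiv_one : frameEquiv hq 1 = frameOne q := by
  rw [frameOne_eq hq, ← Matrix.mulVec_single_one, ← frameEquiv_toComplex hq]
  simp [toComplex_apply]

theorem frameEquiv_I : frameEquiv hq I = frameTwo q := by
  rw [frameTwo_eq hq, ← Matrix.mulVec_single_one, ← frameEquiv_toComplex hq]
  simp [toComplex_apply]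

/-- The action of the circle on the tangent space at `q` by rotations in the reference frame. -/
def frameRotation : Circle →* (Plane ≃ₗ[ℝ] Plane) where
  toFun a := (frameEquiv hq).symm.trans ((rotation a).toLinearEquiv.trans (frameEquiv hq))
  map_one' := by
    ext1 v
    simp
  map_mul' a b := by
    ext1 v
    simp

theorem frameRotation_apply (a : Circle) (v : Plane) :
    frameRotation hq a v = frameEquiv hq (a * (frameEquiv hq).symm v) := by
  simp [frameRotation]

theorem frameRotation_frameEquiv (a : Circle) (w : ℂ) :
    frameRotation hq a (frameEquiv hq w) = frameEquiv hq (a * w) := by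
  rw [frameRotation_apply, LinearEquiv.symm_apply_apply]

theorem frameRotation_injective : Function.Injective (frameRotation hq) := by
  intro a b h
  have h1 := DFunLike.congr_fun h (frameEquiv hq 1)
  rw [frameRotation_frameEquiv, frameRotation_frameEquiv, mul_one, mul_one] at h1
  exact Circle.ext ((frameEquiv hq).injective h1)

theorem isFrameRotation_frameRotation {p : SymTraceless} (hp : chart p ≠ 0) (θ : ℝ) :
    IsFrameRotation p θ (frameRotation hp (Circle.exp θ)) := by
  rw [IsFrameRotation, ← frameEquiv_one hp, ← frameEquiv_I hp, frameRotation_frameEquiv,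
    frameRotation_frameEquiv, Circle.coe_exp, exp_mul_I, ← ofReal_cos, ← ofReal_sin]
  simp only [← map_smul, ← map_add, real_smul]
  constructor <;> congr 1
  · ring
  · push_cast
    linear_combination sin θ * I_mul_I

end

/-! ### Parallel transport -/

theorem toComplex_christoffelForm {q : Plane} (hq : q ≠ 0) (X V : Plane) :
    toComplex (christoffelForm q X V) = -(3 / 8 * I * angularForm q X *
      (toComplex V - sqDirection (toComplex q) * conj (toComplex V))) := by
  have hz := toComplex_ne_zero.2 hq
  have hzc : conj (toComplex q) ≠ 0 := (map_ne_zero _).2 hz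
  rw [christoffelForm_eq hq, map_smul, real_smul, angularForm_eq_im q V]
  push_cast
  rw [im_eq_sub_conj, map_div₀, sqDirection]
  field_simp
  rw [I_sq]
  ring

theorem hasDerivAt_coframeMap {u W : ℝ → ℂ} {σ t : ℝ} (hut : ‖u t‖ = 1)
    (hu : HasDerivAt u (2 * I * σ * u t) t)
    (hW : HasDerivAt W (3 / 8 * I * σ * (W t - u t * conj (W t))) t) :
    HasDerivAt (fun s => coframeMap (u s) (W s)) (I / 2 * σ * coframeMap (u t) (W t)) t := by
  refine (((hW.const_mul 3).add (hu.mul hW.star)).div_const 2).congr_deriv ?_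
  simp only [coframeMap, star_def, map_mul, map_sub, map_div₀, conj_I, conj_ofReal, conj_conj,
    map_ofNat]
  linear_combination (3 / 16 * I * σ * W t) * mul_conj_eq_one hut

theorem hasDerivAt_frameMap {u a : ℝ → ℂ} {σ t : ℝ} (hut : ‖u t‖ = 1)
    (hu : HasDerivAt u (2 * I * σ * u t) t) (ha : HasDerivAt a (I / 2 * σ * a t) t) :
    HasDerivAt (fun s => frameMap (u s) (a s))
      (3 / 8 * I * σ * (frameMap (u t) (a t) - u t * conj (frameMap (u t) (a t)))) t := by
  refine (((ha.const_mul 3).sub (hu.mul ha.star)).div_const 4).congr_deriv ?_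
  simp only [frameMap, star_def, map_mul, map_sub, map_div₀, conj_I, conj_ofReal, conj_conj,
    map_ofNat]
  linear_combination (-(3 / 32) * I * σ * a t) * mul_conj_eq_one hut

theorem isParallelAlong_iff {c : ℝ → SymTraceless} {V : ℝ → Plane} :
    IsParallelAlong c V ↔ ContinuousOn (fun t => toComplex (V t)) (Icc 0 1) ∧
      ∀ t ∈ Ioo (0 : ℝ) 1, complexCurve c t ≠ 0 → DifferentiableAt ℝ (complexCurve c) t →
        HasDerivAt (fun t => toComplex (V t))
          (3 / 8 * I * angularVelocity (complexCurve c) t * (toComplex (V t) -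
            sqDirectionAlong (complexCurve c) t * conj (toComplex (V t)))) t := by
  refine and_congr (toComplex.comp_continuousOn_iff (f := V)).symm (forall₂_congr fun t ht => ?_)
  rw [differentiableAt_complexCurve, Ne, Ne, complexCurve_eq_zero]
  refine forall₂_congr fun hc _ => ?_
  have hz : complexCurve c t ≠ 0 := complexCurve_eq_zero.not.2 hc
  have hval : 3 / 8 * I * angularVelocity (complexCurve c) t * (toComplex (V t) -
      sqDirectionAlong (complexCurve c) t * conj (toComplex (V t))) =
      toComplex (-christoffelForm (coords c t) (velocity c t) (V t)) := by
    rw [map_neg, toComplex_christoffelForm (toComplex_ne_zero.1 hz), ← angularSpeed_eq, neg_neg,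
      sqDirectionAlong, if_neg hz]
    rfl
  rw [hval, hasDerivAt_iff_hasFDerivAt, hasDerivAt_iff_hasFDerivAt]
  refine toComplex.comp_hasFDerivAt_iff.symm.trans (iff_of_eq ?_)
  congr 1
  ext
  simp

section

variable {c : ℝ → SymTraceless} (h : IsRegularCurveOn (complexCurve c) 0 1)

include h

theorem IsParallelAlong.coframeMap_eq {V : ℝ → Plane} (hV : IsParallelAlong c V) {t : ℝ}
    (ht : t ∈ Icc (0 : ℝ) 1) :
    coframeMap (sqDirectionAlong (complexCurve c) t) (toComplex (V t)) =
      exp (I / 2 * sweptAngle (complexCurve c) 0 t) *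
        coframeMap (sqDirectionAlong (complexCurve c) 0) (toComplex (V 0)) := by
  obtain ⟨hcont, hderiv⟩ := isParallelAlong_iff.1 hV
  refine h.eq_cexp_mul_of_hasDerivAt
    (g := fun s => coframeMap (sqDirectionAlong (complexCurve c) s) (toComplex (V s))) ?_ ?_ ht
  · exact ((hcont.const_mul 3).add
      (h.continuousOn_sqDirectionAlong.mul (continuous_conj.comp_continuousOn hcont))).div_const _
  · exact fun s hs hz hd => hasDerivAt_coframeMap
      (h.norm_sqDirectionAlong (Ioo_subset_Icc_self hs)) (hasDerivAt_sqDirectionAlong hz hd)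
      (hderiv s hs hz hd)

theorem isParallelAlong_frameMap (w : ℂ) :
    IsParallelAlong c fun t => toComplex.symm (frameMap (sqDirectionAlong (complexCurve c) t)
      (exp (I / 2 * sweptAngle (complexCurve c) 0 t) * w)) := by
  simp only [isParallelAlong_iff, ContinuousLinearEquiv.apply_symm_apply]
  constructor
  · have hexp : ContinuousOn (fun t => exp (I / 2 * sweptAngle (complexCurve c) 0 t) * w)
        (Icc 0 1) :=
      (continuous_exp.comp_continuousOn (continuousOn_const.mul (continuous_ofReal.comp_continuousOn
        (h.continuousOn_sweptAngle zero_le_one)))).mul_const w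
    exact ((hexp.const_mul 3).sub
      (h.continuousOn_sqDirectionAlong.mul (continuous_conj.comp_continuousOn hexp))).div_const _
  · intro t ht hz hd
    refine hasDerivAt_frameMap (h.norm_sqDirectionAlong (Ioo_subset_Icc_self ht))
      (hasDerivAt_sqDirectionAlong hz hd) ?_
    refine (((h.hasDerivAt_sweptAngle ht hz hd).ofReal_comp.const_mul (I / 2)).cexp.mul_const
      w).congr_deriv ?_
    ring

end

theorem IsLoop.isParallelTransport {U : Set SymTraceless} {p : SymTraceless}
    {c : ℝ → SymTraceless} (h : IsLoop U p c) (hp : chart p ≠ 0) :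
    IsParallelTransport c (frameRotation hp (Circle.exp (geometricPhase c))) := by
  have hc := h.isRegularCurveOn
  have hend {t : ℝ} (ht : c t = p) :
      sqDirectionAlong (complexCurve c) t = sqDirection (toComplex (chart p)) := by
    rw [sqDirectionAlong, complexCurve, coords, ht, if_neg (toComplex_ne_zero.2 hp)]
  have hexp : (Circle.exp (geometricPhase c) : ℂ) =
      exp (I / 2 * sweptAngle (complexCurve c) 0 1) := by
    rw [Circle.coe_exp, geometricPhase_eq hc]
    push_cast
    ring_nf
  intro v w
  rw [frameRotation_apply, hexp]
  constructor
  · rintro rfl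
    refine ⟨_, isParallelAlong_frameMap hc ((frameEquiv hp).symm v), ?_, ?_⟩
    · rw [hend h.start, sweptAngle_self, ofReal_zero, mul_zero, exp_zero, one_mul]
      exact (frameEquiv hp).apply_symm_apply v
    · rw [hend h.finish]
      rfl
  · rintro ⟨V, hV, rfl, rfl⟩
    have h1 := hV.coframeMap_eq hc (right_mem_Icc.2 zero_le_one)
    rw [hend h.start, hend h.finish] at h1
    exact (congrArg (frameEquiv hp) h1.symm).trans ((frameEquiv hp).apply_symm_apply _)

theorem IsParallelTransport.unique {c : ℝ → SymTraceless} {T T' : Plane ≃ₗ[ℝ] Plane}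
    (h : IsParallelTransport c T) (h' : IsParallelTransport c T') : T = T' := by
  ext1 v
  exact (h v (T' v)).2 ((h' v (T' v)).1 rfl)

/-! ### Circles -/

theorem IsRegularCurveOn.sweptAngle_eq_mul {z : ℝ → ℂ} {a b v : ℝ} (h : IsRegularCurveOn z a b)
    (hab : a ≤ b) (hv : ∀ t, z t ≠ 0 → angularVelocity z t = v) :
    sweptAngle z a b = (b - a) * v := by
  rw [sweptAngle, ← smul_eq_mul, ← intervalIntegral.integral_const]
  refine intervalIntegral.integral_congr_ae ?_
  filter_upwards [h.finite_zeros.countable.ae_notMem volume] with t ht hmem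
  rw [uIoc_of_le hab] at hmem
  exact hv t fun h0 => ht ⟨Ioc_subset_Icc_self hmem, h0⟩

theorem re_div_one_add_of_norm_eq_one {e : ℂ} (he : ‖e‖ = 1) (h : 1 + e ≠ 0) :
    (e / (1 + e)).re = 1 / 2 := by
  have hc : 1 + conj e ≠ 0 := by
    rwa [← map_one conj, ← map_add, map_ne_zero]
  have hsum : e / (1 + e) + conj (e / (1 + e)) = 1 := by
    rw [map_div₀, map_add, map_one]
    field_simp
    linear_combination mul_conj_eq_one he
  rw [add_conj] at hsum
  have : 2 * (e / (1 + e)).re = 1 := mod_cast hsum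
  linarith

theorem re_circleMap_zero_div_circleMap_half {θ : ℝ}
    (h : circleMap (1 - (1 / 2 : ℝ)) (1 / 2) θ ≠ 0) :
    (circleMap 0 (1 / 2) θ / circleMap (1 - (1 / 2 : ℝ)) (1 / 2) θ).re = 1 / 2 := by
  have hhalf : circleMap (1 - (1 / 2 : ℝ)) (1 / 2) θ = 1 / 2 * (1 + exp (θ * I)) := by
    rw [circleMap]
    push_cast
    ring
  rw [hhalf] at h ⊢
  rw [circleMap_zero, ofReal_div, ofReal_one, ofReal_ofNat,
    mul_div_mul_left _ _ (left_ne_zero_of_mul h)]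
  exact re_div_one_add_of_norm_eq_one (norm_exp_ofReal_mul_I θ) (right_ne_zero_of_mul h)

/-- The circle of radius `R ‖p‖` through `p` with centre `(1 - R) p`, run through `k` times. -/
def circleLoop (p : SymTraceless) (R : ℝ) (k : ℤ) (t : ℝ) : SymTraceless :=
  chart.symm (toComplex.symm (toComplex (chart p) * circleMap (1 - R) R (2 * Real.pi * k * t)))

theorem complexCurve_circleLoop (p : SymTraceless) (R : ℝ) (k : ℤ) :
    complexCurve (circleLoop p R k) =
      fun t => toComplex (chart p) * circleMap (1 - R) R (2 * Real.pi * k * t) := by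
  ext1 t
  simp only [complexCurve, coords, circleLoop, LinearEquiv.apply_symm_apply,
    ContinuousLinearEquiv.apply_symm_apply]

theorem contDiff_coords_circleLoop (p : SymTraceless) (R : ℝ) (k : ℤ) :
    ContDiff ℝ ∞ (coords (circleLoop p R k)) := by
  have hz : ContDiff ℝ ∞ (complexCurve (circleLoop p R k)) := by
    rw [complexCurve_circleLoop]
    exact contDiff_const.mul ((contDiff_circleMap _ _).comp (contDiff_const.mul contDiff_id))
  exact toComplex.comp_contDiff_iff.1 hz

theorem hasDerivAt_complexCurve_circleLoop (p : SymTraceless) (R : ℝ) (k : ℤ) (t : ℝ) :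
    HasDerivAt (complexCurve (circleLoop p R k))
      (toComplex (chart p) * (2 * Real.pi * k * (circleMap 0 R (2 * Real.pi * k * t) * I))) t := by
  rw [complexCurve_circleLoop]
  refine (((hasDerivAt_circleMap (1 - R) R _).scomp t
    ((hasDerivAt_id t).const_mul (2 * Real.pi * k))).const_mul _).congr_deriv ?_
  simp

theorem circleLoop_periodic (p : SymTraceless) (R : ℝ) (k : ℤ) :
    Function.Periodic (circleLoop p R k) 1 := by
  intro t
  rw [circleLoop, circleLoop, mul_add, mul_one, mul_comm (2 * Real.pi) (k : ℝ),
    (periodic_circleMap _ R).int_mul k]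

theorem circleLoop_zero (p : SymTraceless) (R : ℝ) (k : ℤ) : circleLoop p R k 0 = p := by
  simp [circleLoop, circleMap]

theorem circleLoop_one (p : SymTraceless) (R : ℝ) (k : ℤ) : circleLoop p R k 1 = p := by
  rw [← zero_add (1 : ℝ), circleLoop_periodic, circleLoop_zero]

theorem circleLoop_half_half (p : SymTraceless) : circleLoop p (1 / 2) 1 (1 / 2) = 0 := by
  rw [← complexCurve_eq_zero, complexCurve_circleLoop]
  have hangle : 2 * Real.pi * (1 : ℤ) * (1 / 2 : ℝ) = Real.pi := by
    push_cast
    ring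
  simp only [hangle, circleMap, exp_pi_mul_I]
  push_cast
  ring

section

variable {p : SymTraceless} (hp : p ≠ 0)

include hp

theorem velocity_circleLoop_ne_zero {R : ℝ} (hR : R ≠ 0) {k : ℤ} (hk : k ≠ 0) (t : ℝ) :
    velocity (circleLoop p R k) t ≠ 0 := by
  rw [← deriv_complexCurve_ne_zero, (hasDerivAt_complexCurve_circleLoop p R k t).deriv]
  simp [toComplex_chart_ne_zero.2 hp, hR, hk, circleMap, Real.pi_ne_zero]

theorem isLoop_circleLoop {U : Set SymTraceless} {R : ℝ} (hR : R ≠ 0) (k : ℤ)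
    (hU : ∀ t, circleLoop p R k t ∈ U) : IsLoop U p (circleLoop p R k) := by
  refine isLoop_of_contDiff hp (contDiff_coords_circleLoop p R k) (circleLoop_zero p R k)
    (circleLoop_one p R k) hU fun t ht => velocity_circleLoop_ne_zero hp hR ?_ t
  rintro rfl
  have hconst : circleLoop p R 0 t = circleLoop p R 0 0 := by simp [circleLoop]
  exact hp ((circleLoop_zero p R 0).symm.trans (hconst.symm.trans ht))

theorem isSmoothSimpleClosed_circleLoop {R : ℝ} (hR : R ≠ 0) :
    IsSmoothSimpleClosed (circleLoop p R 1) where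
  smooth := contDiff_coords_circleLoop p R 1
  periodic := circleLoop_periodic p R 1
  regular := velocity_circleLoop_ne_zero hp hR one_ne_zero
  simple s hs t ht hst := by
    rw [← complexCurve_eq_iff, complexCurve_circleLoop] at hst
    have hangle := eq_of_circleMap_eq hR ?_
      (mul_left_cancel₀ (toComplex_chart_ne_zero.2 hp) hst)
    · simpa [Real.pi_ne_zero] using hangle
    · rw [Int.cast_one, mul_one, ← mul_sub, abs_mul, abs_of_pos Real.two_pi_pos]
      exact mul_lt_of_lt_one_right Real.two_pi_pos
        (abs_lt.2 ⟨by linarith [hs.1, ht.2], by linarith [hs.2, ht.1]⟩)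

theorem circleLoop_one_radius_mem_compl (k : ℤ) (t : ℝ) : circleLoop p 1 k t ∈ ({0}ᶜ : Set _) := by
  rw [mem_compl_singleton_iff, Ne, ← complexCurve_eq_zero, complexCurve_circleLoop]
  simp [circleMap, toComplex_chart_ne_zero.2 hp]

theorem angularVelocity_circleLoop (R : ℝ) (k : ℤ) (t : ℝ) :
    angularVelocity (complexCurve (circleLoop p R k)) t =
      2 * Real.pi * k * (circleMap 0 R (2 * Real.pi * k * t) /
        circleMap (1 - R) R (2 * Real.pi * k * t)).re := by
  rw [angularVelocity, (hasDerivAt_complexCurve_circleLoop p R k t).deriv, complexCurve_circleLoop,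
    mul_div_mul_left _ _ (toComplex_chart_ne_zero.2 hp), mul_div_assoc, mul_div_right_comm,
    ← I_mul_im, mul_comm I]
  exact_mod_cast im_ofReal_mul (2 * Real.pi * k) _

theorem windingNumber_circleLoop_one (k : ℤ) : windingNumber (circleLoop p 1 k) = k := by
  have h := (isLoop_circleLoop hp one_ne_zero k fun _ => mem_univ _).isRegularCurveOn
  have hv (t : ℝ) (_ : complexCurve (circleLoop p 1 k) t ≠ 0) :
      angularVelocity (complexCurve (circleLoop p 1 k)) t = 2 * Real.pi * k := by
    rw [angularVelocity_circleLoop hp, ofReal_one, sub_self, div_self, one_re, mul_one]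
    simp [circleMap]
  rw [windingNumber_eq, h.sweptAngle_eq_mul zero_le_one hv]
  field_simp
  ring

theorem windingNumber_circleLoop_half (k : ℤ) : windingNumber (circleLoop p (1 / 2) k) = k / 2 := by
  have h := (isLoop_circleLoop hp one_half_pos.ne' k fun _ => mem_univ _).isRegularCurveOn
  have hv (t : ℝ) (ht : complexCurve (circleLoop p (1 / 2) k) t ≠ 0) :
      angularVelocity (complexCurve (circleLoop p (1 / 2) k)) t = Real.pi * k := by
    rw [complexCurve_circleLoop] at ht
    rw [angularVelocity_circleLoop hp,
      re_circleMap_zero_div_circleMap_half (right_ne_zero_of_mul ht)]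
    ring
  rw [windingNumber_eq, h.sweptAngle_eq_mul zero_le_one hv]
  field_simp
  ring

theorem exists_isLoop_compl_geometricPhase_eq (k : ℤ) :
    ∃ c, IsLoop {0}ᶜ p c ∧ geometricPhase c = k * Real.pi := by
  have h := isLoop_circleLoop hp one_ne_zero k (circleLoop_one_radius_mem_compl hp k)
  refine ⟨_, h, ?_⟩
  rw [geometricPhase_eq_pi_mul h.isRegularCurveOn, windingNumber_circleLoop_one hp, mul_comm]

theorem exists_isLoop_geometricPhase_eq (k : ℤ) :
    ∃ c, IsLoop univ p c ∧ geometricPhase c = k * (Real.pi / 2) := by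
  have h := isLoop_circleLoop hp one_half_pos.ne' k fun _ => mem_univ _
  refine ⟨_, h, ?_⟩
  rw [geometricPhase_eq_pi_mul h.isRegularCurveOn, windingNumber_circleLoop_half hp]
  ring

theorem exists_isSmoothSimpleClosed_compl :
    ∃ c, IsLoop {0}ᶜ p c ∧ IsSmoothSimpleClosed c ∧ windingNumber c = 1 :=
  ⟨_, isLoop_circleLoop hp one_ne_zero 1 (circleLoop_one_radius_mem_compl hp 1),
    isSmoothSimpleClosed_circleLoop hp one_ne_zero,
    by rw [windingNumber_circleLoop_one hp, Int.cast_one]⟩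

theorem exists_isSmoothSimpleClosed_through_zero :
    ∃ c, IsLoop univ p c ∧ IsSmoothSimpleClosed c ∧ (∃ t, c t = 0) ∧ windingNumber c = 1 / 2 :=
  ⟨_, isLoop_circleLoop hp one_half_pos.ne' 1 fun _ => mem_univ _,
    isSmoothSimpleClosed_circleLoop hp one_half_pos.ne', ⟨_, circleLoop_half_half p⟩,
    by rw [windingNumber_circleLoop_half hp, Int.cast_one]⟩

end

/-! ### The holonomy groups -/

theorem orderOf_exp_pi : orderOf (Circle.exp Real.pi) = 2 := by
  have h : (Circle.exp Real.pi : ℂ) = -1 := by rw [Circle.coe_exp, exp_pi_mul_I]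
  refine orderOf_eq_prime (Circle.ext ?_) fun h1 => ?_
  · rw [Circle.coe_pow, h, neg_one_sq, Circle.coe_one]
  · norm_num [h1] at h

theorem orderOf_exp_pi_div_two : orderOf (Circle.exp (Real.pi / 2)) = 4 := by
  have h : Circle.exp (Real.pi / 2) ^ 2 = Circle.exp Real.pi := by
    rw [← Circle.exp_nsmul, nsmul_eq_mul, Nat.cast_two, mul_div_cancel₀ _ two_ne_zero]
  refine orderOf_eq_prime_pow (p := 2) (n := 1) ?_ ?_
  · rw [pow_one, h, ← orderOf_eq_one_iff, orderOf_exp_pi]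
    decide
  · rw [pow_succ, pow_one, pow_mul, h, ← orderOf_exp_pi, pow_orderOf_eq_one]

theorem nonempty_zpowers_frameRotation_mulEquiv {q : Plane} (hq : q ≠ 0) {a : Circle} {n : ℕ}
    (ha : orderOf a = n) :
    Nonempty (Subgroup.zpowers (frameRotation hq a) ≃* Multiplicative (ZMod n)) := by
  rw [← ha, ← orderOf_injective _ (frameRotation_injective hq), ← Nat.card_zpowers]
  exact ⟨(zmodCyclicMulEquiv inferInstance).symm⟩

section

variable {U : Set SymTraceless} {p : SymTraceless} {δ : ℝ}

theorem phases_eq_of_geometricPhase (hmul : ∀ c, IsLoop U p c → ∃ k : ℤ, geometricPhase c = k * δ)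
    (hex : ∀ k : ℤ, ∃ c, IsLoop U p c ∧ geometricPhase c = k * δ) :
    phases U p = {a : Real.Angle | ∃ k : ℤ, a = ((k * δ : ℝ) : Real.Angle)} := by
  ext a
  constructor
  · rintro ⟨c, hc, rfl⟩
    exact (hmul c hc).imp fun k hk => congrArg _ hk
  · rintro ⟨k, rfl⟩
    obtain ⟨c, hc, hk⟩ := hex k
    exact ⟨c, hc, congrArg _ hk.symm⟩

theorem zpowers_frameRotation_eq_holonomy (hp : chart p ≠ 0)
    (hmul : ∀ c, IsLoop U p c → ∃ k : ℤ, geometricPhase c = k * δ)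
    (hex : ∀ k : ℤ, ∃ c, IsLoop U p c ∧ geometricPhase c = k * δ) :
    (Subgroup.zpowers (frameRotation hp (Circle.exp δ)) : Set (Plane ≃ₗ[ℝ] Plane)) =
      holonomy U p := by
  have hpow (k : ℤ) : frameRotation hp (Circle.exp δ) ^ k =
      frameRotation hp (Circle.exp (k * δ)) := by
    rw [← map_zpow, ← zsmul_eq_mul, Circle.exp_zsmul]
  ext T
  constructor
  · rintro ⟨k, rfl⟩
    obtain ⟨c, hc, hk⟩ := hex k
    refine ⟨c, hc, ?_⟩
    simpa only [hpow, hk] using hc.isParallelTransport hp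
  · rintro ⟨c, hc, hT⟩
    obtain ⟨k, hk⟩ := hmul c hc
    refine ⟨k, ?_⟩
    simpa only [hpow, hk] using (hc.isParallelTransport hp).unique hT

theorem IsLoop.zpowers_frameRotation_eq {c : ℝ → SymTraceless} (hc : IsLoop U p c)
    (hp : chart p ≠ 0) {T : Plane ≃ₗ[ℝ] Plane} (hT : IsParallelTransport c T) :
    Subgroup.zpowers (frameRotation hp (Circle.exp (geometricPhase c))) = Subgroup.zpowers T :=
  congrArg _ ((hc.isParallelTransport hp).unique hT)

end

theorem IsSmoothSimpleClosed.zpowers_frameRotation_eq {c : ℝ → SymTraceless}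
    (hc : IsSmoothSimpleClosed c) (hz : ∃ t, c t = 0) (h0 : chart (c 0) ≠ 0)
    {T : Plane ≃ₗ[ℝ] Plane} (hT : IsParallelTransport c T) :
    Subgroup.zpowers (frameRotation h0 (Circle.exp (Real.pi / 2))) = Subgroup.zpowers T := by
  rw [← (hc.isLoop (chart.map_eq_zero_iff.not.1 h0)).zpowers_frameRotation_eq h0 hT]
  rcases hc.windingNumber_and_geometricPhase hz with ⟨-, hθ⟩ | ⟨-, hθ⟩ <;> rw [hθ]
  rw [Circle.exp_neg, map_inv, Subgroup.zpowers_inv]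

end ConeHolonomy

end

open ConeHolonomy in
theorem mainTheorem4 (p : ConeHolonomy.SymTraceless) (hp : p ≠ 0) :
    -- Parallel transport around each loop exists and is the rotation by the geometric phase,
    -- which is `π` times the winding number.
    (∀ c : ℝ → ConeHolonomy.SymTraceless, ConeHolonomy.IsLoop Set.univ p c →
      IntervalIntegrable (ConeHolonomy.phaseDensity c) MeasureTheory.volume 0 1 ∧
      IntervalIntegrable (ConeHolonomy.angularSpeed c) MeasureTheory.volume 0 1 ∧
      ConeHolonomy.geometricPhase c = Real.pi * ConeHolonomy.windingNumber c ∧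
      ∃ T : ConeHolonomy.Plane ≃ₗ[ℝ] ConeHolonomy.Plane,
        ConeHolonomy.IsParallelTransport c T ∧
        ConeHolonomy.IsFrameRotation p (ConeHolonomy.geometricPhase c) T) ∧
    -- The holonomy group of `Σ ∖ {0}`.
    (∃ H : Subgroup (ConeHolonomy.Plane ≃ₗ[ℝ] ConeHolonomy.Plane),
      (H : Set (ConeHolonomy.Plane ≃ₗ[ℝ] ConeHolonomy.Plane)) = ConeHolonomy.holonomy {0}ᶜ p ∧
      Nonempty (H ≃* Multiplicative (ZMod 2)) ∧
      ConeHolonomy.phases {0}ᶜ p =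
        {a : Real.Angle | ∃ k : ℤ, a = (((k : ℝ) * Real.pi : ℝ) : Real.Angle)} ∧
      (∃ c : ℝ → ConeHolonomy.SymTraceless, ConeHolonomy.IsLoop {0}ᶜ p c ∧
        ConeHolonomy.IsSmoothSimpleClosed c ∧ ConeHolonomy.windingNumber c = 1) ∧
      (∀ c : ℝ → ConeHolonomy.SymTraceless, ConeHolonomy.IsLoop {0}ᶜ p c →
        ConeHolonomy.windingNumber c = 1 →
          ConeHolonomy.geometricPhase c = Real.pi ∧
          ∀ T : ConeHolonomy.Plane ≃ₗ[ℝ] ConeHolonomy.Plane,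
            ConeHolonomy.IsParallelTransport c T → H = Subgroup.zpowers T)) ∧
    -- The holonomy group of `Σ`.
    (∃ H : Subgroup (ConeHolonomy.Plane ≃ₗ[ℝ] ConeHolonomy.Plane),
      (H : Set (ConeHolonomy.Plane ≃ₗ[ℝ] ConeHolonomy.Plane)) =
        ConeHolonomy.holonomy Set.univ p ∧
      Nonempty (H ≃* Multiplicative (ZMod 4)) ∧
      ConeHolonomy.phases Set.univ p =
        {a : Real.Angle | ∃ k : ℤ, a = (((k : ℝ) * (Real.pi / 2) : ℝ) : Real.Angle)} ∧
      (∃ c : ℝ → ConeHolonomy.SymTraceless, ConeHolonomy.IsLoop Set.univ p c ∧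
        ConeHolonomy.IsSmoothSimpleClosed c ∧ (∃ t, c t = 0) ∧
        ConeHolonomy.windingNumber c = 1 / 2) ∧
      (∀ c : ℝ → ConeHolonomy.SymTraceless, ConeHolonomy.IsSmoothSimpleClosed c →
        (∃ t, c t = 0) →
          ((ConeHolonomy.windingNumber c = 1 / 2 ∧
              ConeHolonomy.geometricPhase c = Real.pi / 2) ∨
            (ConeHolonomy.windingNumber c = -(1 / 2) ∧
              ConeHolonomy.geometricPhase c = -(Real.pi / 2))) ∧
          (c 0 = p → ∀ T : ConeHolonomy.Plane ≃ₗ[ℝ] ConeHolonomy.Plane,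
            ConeHolonomy.IsParallelTransport c T → H = Subgroup.zpowers T))) := by
  have hq : chart p ≠ 0 := chart.map_eq_zero_iff.not.2 hp
  have hmul₁ (c) (hc : IsLoop {0}ᶜ p c) := hc.exists_geometricPhase_eq_int_mul_of_compl
  have hmul₂ (c) (hc : IsLoop Set.univ p c) := hc.exists_geometricPhase_eq_int_mul hp
  have hex₁ := exists_isLoop_compl_geometricPhase_eq hp
  have hex₂ := exists_isLoop_geometricPhase_eq hp
  refine ⟨fun c hc => ⟨intervalIntegrable_phaseDensity hc.isRegularCurveOn,
      intervalIntegrable_angularSpeed hc.isRegularCurveOn,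
      geometricPhase_eq_pi_mul hc.isRegularCurveOn, _, hc.isParallelTransport hq,
      isFrameRotation_frameRotation hq _⟩,
    ⟨_, zpowers_frameRotation_eq_holonomy hq hmul₁ hex₁,
      nonempty_zpowers_frameRotation_mulEquiv hq orderOf_exp_pi,
      phases_eq_of_geometricPhase hmul₁ hex₁, exists_isSmoothSimpleClosed_compl hp,
      fun c hc hW => ?_⟩,
    ⟨_, zpowers_frameRotation_eq_holonomy hq hmul₂ hex₂,
      nonempty_zpowers_frameRotation_mulEquiv hq orderOf_exp_pi_div_two,
      phases_eq_of_geometricPhase hmul₂ hex₂, exists_isSmoothSimpleClosed_through_zero hp,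
      fun c hc hz => ⟨hc.windingNumber_and_geometricPhase hz, ?_⟩⟩⟩
  · have hθ : geometricPhase c = Real.pi := by
      rw [geometricPhase_eq_pi_mul hc.isRegularCurveOn, hW, mul_one]
    exact ⟨hθ, fun T hT => hθ ▸ hc.zpowers_frameRotation_eq hq hT⟩
  · rintro rfl T hT
    exact hc.zpowers_frameRotation_eq hz hq hT
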